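/- **Conventions.** Let $k$ be a field. A quiver $Q$ consists of vertices and arrows with source and target (loops and multiple arrows are allowed); it is *finite* if it has finitely many vertices and arrows, and *connected* if it is nonempty and its underlying graph is connected. For a finite quiver $Q$, the path algebra $kQ$ has the paths of $Q$ (including a stationary path $e_x$ for each vertex $x$) as a $k$-basis, and the product of two paths is their composition if it is defined and $0$ otherwise. Let $F$ be the two-sided ideal of $kQ$ generated by the arrows. A two-sided ideal $I$ is *admissible* if $F^m\subseteq I\subseteq F^2$ for some $m\ge 2$. A *presentation* of a $k$-algebra $A$ is a pair $(Q,I)$ with $Q$ a finite connected quiver and $I$ an admissible ideal of $kQ$ such that $A\cong kQ/I$ as $k$-algebras. The quiver $Q$ is then determined by $A$ and is denoted $Q_A$. A *minimal relation* of $I$ is an element $\sum_{i=1}^m\lambda_i w_i\in I$, where $m\ge 2$, the $\lambda_i\in k$ are nonzero and the $w_i$ are pairwise different paths with a common source and a common target, such that $\sum_{i\in J}\lambda_i w_i\notin I$ for every nonempty proper subset $J\subset\{1,\dots,m\}$. A *walk* is a composition of arrows and formal inverses of arrows. *Homotopy* is the smallest equivalence relation $\sim$ on walks such that (1) $\alpha\alpha^{-1}\sim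 e_x$ and $\alpha^{-1}\alpha\sim e_y$ for every arrow $\alpha\colon x\to y$; (2) $w_i\sim w_j$ whenever $w_i,w_j$ occur in the same minimal relation of $I$; (3) $u\sim v$ implies $wuw'\sim wvw'$ whenever these compositions are defined. The fundamental group $\pi_1(Q,I,v_0)$ is the group of homotopy classes of closed walks at the vertex $v_0$, with the product induced by composition of walks; for connected $Q$ its isomorphism class does not depend on $v_0$ and one writes $\pi_1(Q,I)$. **Theorem A.** Let $G_1,\dots,G_n$ be finitely presented groups. Then there exist a finite-dimensional $k$-algebra $A$ and presentations $A\cong kQ_A/I_i$, $1\le i\le n$, all on the same quiver $Q_A$, such that $\pi_1(Q_A,I_i)\cong G_i$ for every $i\in\{1,\dots,n\}$. -/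

import Mathlib

universe u v w

noncomputable section

namespace BoundQuiver

open Quiver

/-- The quiver `Q` is finite: it has finitely many vertices and finitely many arrows. -/
def IsFiniteQuiver (Q : Type v) [Quiver.{w} Q] : Prop :=
  Finite Q ∧ ∀ x y : Q, Finite (x ⟶ y)

/-- The quiver `Q` is connected: its underlying graph is nonempty and any two vertices are joined
by a walk (a path in the quiver with formal inverses of all arrows added). -/
def IsConnectedQuiver (Q : Type v) [Quiver.{w} Q] : Prop :=
  Nonempty Q ∧ ∀ x y : Symmetrify Q, Nonempty (Path x y)

/-! ### The path algebra -/

/-- All paths of `Q`, with their source and target; `⟨x, x, Path.nil⟩` is the stationary path. -/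
abbrev AnyPath (Q : Type v) [Quiver.{w} Q] : Type max v w := Σ x y : Q, Path x y

/-- The path algebra `kQ`: the `k`-vector space with the set of all paths of `Q` as a basis. -/
def PathAlgebra (k : Type u) [Field k] (Q : Type v) [Quiver.{w} Q] : Type max u v w :=
  AnyPath Q →₀ k

namespace PathAlgebra

variable {k : Type u} [Field k] {Q : Type v} [Quiver.{w} Q]

instance : AddCommGroup (PathAlgebra k Q) := inferInstanceAs (AddCommGroup (AnyPath Q →₀ k))

instance : Module k (PathAlgebra k Q) := inferInstanceAs (Module k (AnyPath Q →₀ k))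

variable (k) in
/-- The basis element of `kQ` given by a path with recorded end points. -/
def of (p : AnyPath Q) : PathAlgebra k Q := Finsupp.single p 1

variable (k) in
/-- The basis element of `kQ` given by a path from `x` to `y`. -/
def ofPath {x y : Q} (p : Path x y) : PathAlgebra k Q := of k ⟨x, y, p⟩

variable (k Q) in
/-- The paths form a basis of `kQ`. -/
def basis : Module.Basis (AnyPath Q) k (PathAlgebra k Q) :=
  Module.Basis.ofRepr (LinearEquiv.refl k (AnyPath Q →₀ k))

theorem basis_apply (p : AnyPath Q) : basis k Q p = of k p := rfl

theorem lin_ext {M : Type*} [AddCommGroup M] [Module k M] {f g : PathAlgebra k Q →ₗ[k] M}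
    (h : ∀ p, f (of k p) = g (of k p)) : f = g :=
  (basis k Q).ext h

open Classical in
variable (k) in
/-- The product of two basis elements: the composition `pq` (first `p`, then `q`) if the target of
`p` is the source of `q`, and `0` otherwise. -/
def mulPaths (p q : AnyPath Q) : PathAlgebra k Q :=
  if h : p.2.1 = q.1 then ofPath k ((p.2.2.cast rfl h).comp q.2.2) else 0

variable (k Q) in
/-- The bilinear extension of the multiplication of paths. -/
def mulBilin : PathAlgebra k Q →ₗ[k] PathAlgebra k Q →ₗ[k] PathAlgebra k Q :=
  (basis k Q).constr k fun p => (basis k Q).constr k fun q => mulPaths k p q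

instance : Mul (PathAlgebra k Q) := ⟨fun f g => mulBilin k Q f g⟩

theorem mul_def (f g : PathAlgebra k Q) : f * g = mulBilin k Q f g := rfl

theorem of_mul_of (p q : AnyPath Q) : of k p * of k q = mulPaths k p q := by
  rw [mul_def, mulBilin, ← basis_apply, Module.Basis.constr_basis, ← basis_apply,
    Module.Basis.constr_basis]

theorem ofPath_mul_ofPath {x y z : Q} (p : Path x y) (q : Path y z) :
    ofPath k p * ofPath k q = ofPath k (p.comp q) := by
  simp [ofPath, of_mul_of, mulPaths]

theorem ofPath_mul_ofPath_of_ne {x y y' z : Q} (h : y ≠ y') (p : Path x y) (q : Path y' z) :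
    ofPath k p * ofPath k q = 0 := by
  simp [ofPath, of_mul_of, mulPaths, h]

theorem mul_assoc_basis (p q r : AnyPath Q) :
    of k p * of k q * of k r = of k p * (of k q * of k r) := by
  obtain ⟨a, b, p⟩ := p
  obtain ⟨c, d, q⟩ := q
  obtain ⟨e, f, r⟩ := r
  change ofPath k p * ofPath k q * ofPath k r = ofPath k p * (ofPath k q * ofPath k r)
  have z1 : ∀ x : PathAlgebra k Q, 0 * x = 0 := fun x => by simp [mul_def]
  have z2 : ∀ x : PathAlgebra k Q, x * 0 = 0 := fun x => by simp [mul_def]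
  by_cases h : b = c
  · subst h
    by_cases h' : d = e
    · subst h'
      simp only [ofPath_mul_ofPath, Path.comp_assoc]
    · simp only [ofPath_mul_ofPath, ofPath_mul_ofPath_of_ne h', z2]
  · by_cases h' : d = e
    · subst h'
      simp only [ofPath_mul_ofPath, ofPath_mul_ofPath_of_ne h, z1]
    · simp only [ofPath_mul_ofPath_of_ne h, ofPath_mul_ofPath_of_ne h', z1, z2]

instance : NonUnitalRing (PathAlgebra k Q) where
  left_distrib f g h := by simp [mul_def]
  right_distrib f g h := by simp [mul_def]
  zero_mul f := by simp [mul_def]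
  mul_zero f := by simp [mul_def]
  mul_assoc f g h := by
    have h1 : (mulBilin k Q).compr₂ (mulBilin k Q) =
        ((LinearMap.llcomp k _ _ _ ∘ₗ mulBilin k Q).flip ∘ₗ mulBilin k Q).flip := by
      refine lin_ext fun p => lin_ext fun q => lin_ext fun r => ?_
      exact mul_assoc_basis p q r
    exact congrArg (fun T => T f g h) h1

variable [Fintype Q]

/-- The identity of `kQ` is the sum of all stationary paths. -/
instance : One (PathAlgebra k Q) := ⟨∑ x : Q, ofPath k (Path.nil : Path x x)⟩

theorem one_def : (1 : PathAlgebra k Q) = ∑ x : Q, ofPath k (Path.nil : Path x x) := rfl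

theorem one_mul_of (p : AnyPath Q) : 1 * of k p = of k p := by
  obtain ⟨a, b, p⟩ := p
  change 1 * ofPath k p = ofPath k p
  rw [one_def, Finset.sum_mul, Finset.sum_eq_single a]
  · simp [ofPath_mul_ofPath]
  · intro x _ hx
    exact ofPath_mul_ofPath_of_ne hx _ _
  · simp

theorem of_mul_one (p : AnyPath Q) : of k p * 1 = of k p := by
  obtain ⟨a, b, p⟩ := p
  change ofPath k p * 1 = ofPath k p
  rw [one_def, Finset.mul_sum, Finset.sum_eq_single b]
  · simp [ofPath_mul_ofPath]
  · intro x _ hx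
    exact ofPath_mul_ofPath_of_ne hx.symm _ _
  · simp

instance : Ring (PathAlgebra k Q) where
  __ := (inferInstance : NonUnitalRing (PathAlgebra k Q))
  one_mul f := by
    have h : mulBilin k Q 1 = LinearMap.id := lin_ext fun p => one_mul_of p
    exact congrArg (fun T => T f) h
  mul_one f := by
    have h : (mulBilin k Q).flip 1 = LinearMap.id := lin_ext fun p => of_mul_one p
    exact congrArg (fun T => T f) h

instance : Algebra k (PathAlgebra k Q) :=
  Algebra.ofModule (fun r f g => by simp [mul_def]) (fun r f g => by simp [mul_def])

end PathAlgebra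

/-! ### Admissible ideals and presentations -/

section Ideals

variable (k : Type u) [Field k] (Q : Type v) [Quiver.{w} Q] [Fintype Q]

/-- The two-sided ideal `F` of `kQ` generated by the arrows of `Q`. -/
def arrowIdeal : TwoSidedIdeal (PathAlgebra k Q) :=
  TwoSidedIdeal.span {f | ∃ (x y : Q) (a : x ⟶ y), f = PathAlgebra.ofPath k a.toPath}

variable {k Q}

/-- The two-sided ideal `I` is admissible: `F ^ m ⊆ I ⊆ F ^ 2` for some `m ≥ 2`. -/
def IsAdmissible (I : TwoSidedIdeal (PathAlgebra k Q)) : Prop :=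
  ∃ m : ℕ, 2 ≤ m ∧ (arrowIdeal k Q).asIdeal ^ m ≤ I.asIdeal ∧
    I.asIdeal ≤ (arrowIdeal k Q).asIdeal ^ 2

/-- `(Q, I)` is a presentation of the `k`-algebra `A`: the quiver `Q` is finite and connected, the
two-sided ideal `I` of `kQ` is admissible, and `A ≅ kQ/I` as `k`-algebras. -/
structure IsPresentation (A : Type*) [Ring A] [Algebra k A]
    (I : TwoSidedIdeal (PathAlgebra k Q)) : Prop where
  finite : IsFiniteQuiver Q
  connected : IsConnectedQuiver Q
  admissible : IsAdmissible I
  iso : Nonempty (A ≃ₐ[k] PathAlgebra k Q ⧸ I.asIdeal)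

/-! ### The fundamental group -/

/-- `∑_{p ∈ S} c p • p` is a minimal relation of `I` from `x` to `y`: it is a combination with
nonzero coefficients of at least two different paths from `x` to `y`, it lies in `I`, and no
subsum over a nonempty proper subset of these paths lies in `I`. -/
structure IsMinimalRelation (I : TwoSidedIdeal (PathAlgebra k Q)) {x y : Q}
    (S : Finset (Path x y)) (c : Path x y → k) : Prop where
  two_le_card : 2 ≤ S.card
  coeff_ne_zero : ∀ p ∈ S, c p ≠ 0
  mem : ∑ p ∈ S, c p • PathAlgebra.ofPath k p ∈ I
  minimal : ∀ J : Finset (Path x y), J ⊂ S → J.Nonempty →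
    ∑ p ∈ J, c p • PathAlgebra.ofPath k p ∉ I

/-- Walks from `x` to `y`: compositions of arrows and of formal inverses of arrows. The quiver
`Symmetrify Q` has the vertices of `Q`, and the arrows of `Q` together with their formal inverses;
`Quiver.reverse` interchanges `α` and `α⁻¹`. -/
abbrev Walk (x y : Symmetrify Q) : Type max v w := Path x y

/-- A path, regarded as a walk. -/
def toWalk {x y : Q} (p : Path x y) : Walk (Symmetrify.of.obj x) (Symmetrify.of.obj y) :=
  Symmetrify.of.mapPath p

/-- The homotopy relation on walks: the smallest equivalence relation that identifies `e e⁻¹` with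
a stationary walk, where `e = α` or `e = α⁻¹` for an arrow `α`, that identifies any two paths
occurring in the same minimal relation, and that is compatible with composition of walks. -/
inductive Homotopic (I : TwoSidedIdeal (PathAlgebra k Q)) :
    {x y : Symmetrify Q} → Walk x y → Walk x y → Prop
  | refl {x y : Symmetrify Q} (p : Walk x y) : Homotopic I p p
  | symm {x y : Symmetrify Q} {p q : Walk x y} : Homotopic I p q → Homotopic I q p
  | trans {x y : Symmetrify Q} {p q r : Walk x y} :
      Homotopic I p q → Homotopic I q r → Homotopic I p r
  | cancel {x y : Symmetrify Q} (e : x ⟶ y) :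
      Homotopic I (e.toPath.comp (Quiver.reverse e).toPath) Path.nil
  | relation {x y : Q} {S : Finset (Path x y)} {c : Path x y → k} (h : IsMinimalRelation I S c)
      {p q : Path x y} (hp : p ∈ S) (hq : q ∈ S) : Homotopic I (toWalk p) (toWalk q)
  | comp {x y z t : Symmetrify Q} (p : Walk x y) {q q' : Walk y z} (r : Walk z t) :
      Homotopic I q q' → Homotopic I ((p.comp q).comp r) ((p.comp q').comp r)

/-- Homotopy of closed walks at `v₀`. -/
def homotopySetoid (I : TwoSidedIdeal (PathAlgebra k Q)) (v₀ : Symmetrify Q) :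
    Setoid (Walk v₀ v₀) where
  r := Homotopic I
  iseqv := ⟨Homotopic.refl, Homotopic.symm, Homotopic.trans⟩

/-- The fundamental group `π₁(Q, I, v₀)`: homotopy classes of closed walks at the vertex `v₀`. -/
def FundamentalGroup (I : TwoSidedIdeal (PathAlgebra k Q)) (v₀ : Q) : Type max v w :=
  Quotient (homotopySetoid I (Symmetrify.of.obj v₀))

namespace Homotopic

variable {I : TwoSidedIdeal (PathAlgebra k Q)} {x y z : Symmetrify Q}

theorem comp_right {p p' : Walk x y} (h : Homotopic I p p') (q : Walk y z) :
    Homotopic I (p.comp q) (p'.comp q) := by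
  have := Homotopic.comp (Path.nil : Walk x x) q h
  rwa [Path.nil_comp, Path.nil_comp] at this

theorem comp_left (p : Walk x y) {q q' : Walk y z} (h : Homotopic I q q') :
    Homotopic I (p.comp q) (p.comp q') :=
  Homotopic.comp p Path.nil h

theorem comp_reverse (p : Walk x y) : Homotopic I (p.comp p.reverse) Path.nil := by
  induction p with
  | nil => exact Homotopic.refl _
  | cons p e ih =>
    have h2 := Homotopic.comp p p.reverse (Homotopic.cancel (I := I) e)
    have e1 : Path.comp (Path.cons p e) (Path.reverse (Path.cons p e)) =
        (p.comp (e.toPath.comp (Quiver.reverse e).toPath)).comp p.reverse := by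
      rw [Path.reverse, ← Path.comp_toPath_eq_cons]
      simp only [Path.comp_assoc]
    rw [e1]
    exact h2.trans ih

theorem reverse_comp (p : Walk x y) : Homotopic I (p.reverse.comp p) Path.nil := by
  have h := comp_reverse (I := I) p.reverse
  rwa [Path.reverse_reverse] at h

theorem reverse {p q : Walk x y} (h : Homotopic I p q) : Homotopic I p.reverse q.reverse := by
  have h1 : Homotopic I (p.reverse.comp (q.comp q.reverse)) p.reverse :=
    comp_left p.reverse (comp_reverse q)
  have h2 := comp_right ((comp_left p.reverse h.symm).trans (reverse_comp p)) q.reverse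
  rw [Path.nil_comp, Path.comp_assoc] at h2
  exact h1.symm.trans h2

end Homotopic

/-- The group law of `π₁(Q, I, v₀)` is induced by the composition of walks. -/
instance (I : TwoSidedIdeal (PathAlgebra k Q)) (v₀ : Q) : Group (FundamentalGroup I v₀) where
  mul := Quotient.map₂ (fun p q : Walk (Symmetrify.of.obj v₀) (Symmetrify.of.obj v₀) => Path.comp p q)
    fun _ p' hp q _ hq => (Homotopic.comp_right hp q).trans (Homotopic.comp_left p' hq)
  one := Quotient.mk (homotopySetoid I (Symmetrify.of.obj v₀)) Path.nil
  inv := Quotient.map (fun p : Walk (Symmetrify.of.obj v₀) (Symmetrify.of.obj v₀) => Path.reverse p)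
    fun _ _ h => Homotopic.reverse h
  mul_assoc := by
    rintro ⟨p⟩ ⟨q⟩ ⟨r⟩
    exact congrArg (Quotient.mk (homotopySetoid I (Symmetrify.of.obj v₀))) (Path.comp_assoc p q r)
  one_mul := by
    rintro ⟨p⟩
    exact congrArg (Quotient.mk (homotopySetoid I (Symmetrify.of.obj v₀))) (Path.nil_comp p)
  mul_one := by
    rintro ⟨p⟩
    exact congrArg (Quotient.mk (homotopySetoid I (Symmetrify.of.obj v₀))) (Path.comp_nil p)
  inv_mul_cancel := by
    rintro ⟨p⟩
    exact Quotient.sound (s := homotopySetoid I (Symmetrify.of.obj v₀)) (Homotopic.reverse_comp p)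

end Ideals

end BoundQuiver

end

/-!
Every finitely presented group has a finite presentation whose relators all have the form `x y z⁻¹`.
Put such presentations of the groups `G i` side by side on a set `Y` of generators and take the
quiver with arrows `a x`, `b x` (`x` in `Y` or trivial) and `c y` (`y` in `Y`). The commutativity
relations `a y b 1 - a 1 b y` and `a x b y - a z b 1` identify the class of `b y` with that of
`a y` and impose the relator `x y z⁻¹`, while the monomial relations `a y c y` leave homotopy
unchanged. Substituting `a y - a 1` for `a y` and `b y - b 1` for `b y` is an automorphism of the
path algebra, so it does not change the quotient, but it turns `a y c y` into the minimal relation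
`a y c y - a 1 c y`, which kills the generator `y`. Applied to the generators outside of the `i`-th
block, this leaves the group `G i`.

Distinct paths lie in a common minimal relation only if they have the same weight for every grading
of the ideal, so weights in the expected group give a homomorphism from the fundamental group, and
it inverts the evident homomorphism to it.
-/

noncomputable section

namespace BoundQuiver

open Quiver

section TrianglePresentation

/-- The relators `x y z⁻¹` prescribed by a partial multiplication table `T` on the generators. -/
def triangleRels {Y : Type*} (T : Y → Y → Y → Prop) : Set (FreeGroup Y) :=
  {r | ∃ x y z, T x y z ∧ FreeGroup.of x * FreeGroup.of y * (FreeGroup.of z)⁻¹ = r}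

theorem of_mul_of_eq_of_triangleRels_subset {Y : Type*} {T : Y → Y → Y → Prop}
    {rels : Set (FreeGroup Y)} (h : triangleRels T ⊆ rels) {x y z : Y} (hT : T x y z) :
    (PresentedGroup.of x * PresentedGroup.of y : PresentedGroup rels) = PresentedGroup.of z := by
  rw [← mul_inv_eq_one]
  exact PresentedGroup.one_of_mem (h ⟨x, y, z, hT, rfl⟩)

theorem lift_eq_one_of_mem_triangleRels {Y H : Type*} [Group H] {T : Y → Y → Y → Prop} {f : Y → H}
    (hf : ∀ x y z, T x y z → f x * f y = f z) {r : FreeGroup Y} (hr : r ∈ triangleRels T) :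
    FreeGroup.lift f r = 1 := by
  obtain ⟨x, y, z, hT, rfl⟩ := hr
  simp [hf x y z hT]

/-- The relators of the table `T` together with the generators in `S`. -/
def killingRels {Y : Type*} (T : Y → Y → Y → Prop) (S : Set Y) : Set (FreeGroup Y) :=
  triangleRels T ∪ FreeGroup.of '' S

theorem of_eq_one_of_mem {Y : Type*} (T : Y → Y → Y → Prop) {S : Set Y} {y : Y} (hy : y ∈ S) :
    (PresentedGroup.of y : PresentedGroup (killingRels T S)) = 1 :=
  PresentedGroup.one_of_mem (Or.inr ⟨y, hy, rfl⟩)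

theorem lift_eq_one_of_mem_killingRels {Y H : Type*} [Group H] {T : Y → Y → Y → Prop} {S : Set Y}
    {f : Y → H} (hf : ∀ x y z, T x y z → f x * f y = f z) (hS : ∀ y ∈ S, f y = 1) :
    ∀ r ∈ killingRels T S, FreeGroup.lift f r = 1 := by
  rintro r (hr | ⟨y, hy, rfl⟩)
  · exact lift_eq_one_of_mem_triangleRels hf hr
  · rw [FreeGroup.lift_apply_of, hS y hy]

/-- Each product in the table `T` involves only generators in `S` or only generators outside of
`S`. -/
def IsSaturated {Y : Type*} (T : Y → Y → Y → Prop) (S : Set Y) : Prop :=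
  ∀ ⦃x y z : Y⦄, T x y z → (x ∈ S ↔ z ∈ S) ∧ (y ∈ S ↔ z ∈ S)

section Words

variable {α G : Type*} [Group G] (φ : FreeGroup α →* G) (N : ℕ)

/-- The multiplication table of `G` on the words of length at most `N + 1` in the letters `α` and
their inverses, evaluated by `φ`. -/
def wordTable (u v w : {l : List (α × Bool) // l.length ≤ N + 1}) : Prop :=
  φ (FreeGroup.mk u.1) * φ (FreeGroup.mk v.1) = φ (FreeGroup.mk w.1)

/-- The group presented by the multiplication table of short words. -/
abbrev WordGroup : Type _ := PresentedGroup (triangleRels (wordTable φ N))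

variable {φ N}

theorem of_mul_of_word {u v w : {l : List (α × Bool) // l.length ≤ N + 1}}
    (h : wordTable φ N u v w) :
    (PresentedGroup.of u * PresentedGroup.of v : WordGroup φ N) = PresentedGroup.of w :=
  of_mul_of_eq_of_triangleRels_subset subset_rfl h

theorem of_word_eq_one {w : {l : List (α × Bool) // l.length ≤ N + 1}}
    (hw : φ (FreeGroup.mk w.1) = 1) : (PresentedGroup.of w : WordGroup φ N) = 1 :=
  mul_eq_left.1 (of_mul_of_word (by rw [wordTable, hw, one_mul] : wordTable φ N w w w))

variable (φ N) in
/-- The homomorphism sending a letter to the corresponding one-letter word. -/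
def letterHom : FreeGroup α →* WordGroup φ N :=
  FreeGroup.lift fun a => PresentedGroup.of ⟨[(a, true)], by simp⟩

theorem of_letter : ∀ a : α × Bool,
    (PresentedGroup.of ⟨[a], by simp⟩ : WordGroup φ N) = letterHom φ N (FreeGroup.mk [a])
  | (a, true) => (FreeGroup.lift_apply_of ..).symm
  | (a, false) => by
    have hcancel : wordTable φ N ⟨[(a, true)], by simp⟩ ⟨[(a, false)], by simp⟩ ⟨[], by simp⟩ := by
      rw [wordTable, ← map_mul]
      exact congrArg φ (mul_inv_cancel (FreeGroup.of a))
    have hinv : (FreeGroup.mk [(a, false)] : FreeGroup α) = (FreeGroup.of a)⁻¹ := rfl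
    rw [hinv, map_inv, letterHom, FreeGroup.lift_apply_of]
    refine (inv_eq_of_mul_eq_one_right ?_).symm
    rw [of_mul_of_word hcancel, of_word_eq_one (map_one φ)]

theorem of_word (l : List (α × Bool)) (hl : l.length ≤ N + 1) :
    (PresentedGroup.of ⟨l, hl⟩ : WordGroup φ N) = letterHom φ N (FreeGroup.mk l) := by
  induction l using List.reverseRecOn with
  | nil => exact (of_word_eq_one (map_one φ)).trans (map_one _).symm
  | append_singleton l a ih =>
    have hl' : l.length ≤ N + 1 := by
      rw [List.length_append] at hl
      omega
    rw [← FreeGroup.mul_mk, map_mul, ← ih hl', ← of_letter]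
    exact (of_mul_of_word (by rw [wordTable, ← map_mul, FreeGroup.mul_mk])).symm

theorem letterHom_surjective : Function.Surjective (letterHom φ N) := by
  rw [← MonoidHom.range_eq_top, ← top_le_iff, ← PresentedGroup.closure_range_of,
    Subgroup.closure_le]
  rintro _ ⟨w, rfl⟩
  exact ⟨FreeGroup.mk w.1, (of_word w.1 w.2).symm⟩

theorem ker_letterHom [DecidableEq α] {S : Set (FreeGroup α)}
    (hS : Subgroup.normalClosure S = φ.ker)
    (hN : ∀ r ∈ S, r.toWord.length ≤ N) : (letterHom φ N).ker = φ.ker := by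
  apply le_antisymm
  · let ε : WordGroup φ N →* G :=
      PresentedGroup.toGroup fun _ => lift_eq_one_of_mem_triangleRels
        (T := wordTable φ N) (f := fun w => φ (FreeGroup.mk w.1)) fun _ _ _ => id
    have hε : ε.comp (letterHom φ N) = φ := by
      ext a
      rw [MonoidHom.comp_apply, letterHom, FreeGroup.lift_apply_of, PresentedGroup.toGroup.of,
        FreeGroup.of]
    intro r hr
    rw [MonoidHom.mem_ker] at hr ⊢
    rw [← hε, MonoidHom.comp_apply, hr, map_one]
  · rw [← hS]
    refine Subgroup.normalClosure_le_normal fun r hr => ?_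
    have hφr : φ r = 1 := by
      rw [← MonoidHom.mem_ker, ← hS]
      exact Subgroup.subset_normalClosure hr
    rw [SetLike.mem_coe, MonoidHom.mem_ker, ← FreeGroup.mk_toWord (x := r),
      ← of_word _ ((hN r hr).trans N.le_succ)]
    exact of_word_eq_one (by rw [FreeGroup.mk_toWord, hφr])

end Words

theorem exists_mulEquiv_presentedGroup_triangleRels {G : Type*} [Group G]
    (hG : Group.IsFinitelyPresented G) :
    ∃ (Y : Type) (_ : Finite Y) (T : Y → Y → Y → Prop),
      Nonempty (PresentedGroup (triangleRels T) ≃* G) := by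
  obtain ⟨n, φ, hφ, S, hS, hker⟩ := hG.out
  obtain ⟨N, hN⟩ := (hS.image fun r => r.toWord.length).bddAbove
  refine ⟨{l : List (Fin n × Bool) // l.length ≤ N + 1},
    (List.finite_length_le (Fin n × Bool) (N + 1)).to_subtype, wordTable φ N, ⟨?_⟩⟩
  have hker' : (letterHom φ N).ker = φ.ker :=
    ker_letterHom hker fun r hr => hN (Set.mem_image_of_mem _ hr)
  exact (QuotientGroup.quotientKerEquivOfSurjective _ letterHom_surjective).symm.trans
    ((QuotientGroup.quotientMulEquivOfEq hker').trans
      (QuotientGroup.quotientKerEquivOfSurjective φ hφ))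

section Sigma

variable {ι : Type*} {X : ι → Type*} (T : ∀ i, X i → X i → X i → Prop)

/-- The tables `T i` placed side by side on the disjoint union of their sets of generators. -/
inductive SigmaTable : (Σ i, X i) → (Σ i, X i) → (Σ i, X i) → Prop
  | mk {i : ι} {x y z : X i} (h : T i x y z) : SigmaTable ⟨i, x⟩ ⟨i, y⟩ ⟨i, z⟩

/-- The generators outside of the block `i`. -/
def otherBlocks (X : ι → Type*) (i : ι) : Set (Σ i, X i) :=
  {y | y.1 ≠ i}

theorem isSaturated_otherBlocks (i : ι) : IsSaturated (SigmaTable T) (otherBlocks X i) := by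
  rintro _ _ _ ⟨_⟩
  exact ⟨Iff.rfl, Iff.rfl⟩

variable {T}

theorem lift_mulSingle_eq_one [DecidableEq ι] {i : ι} :
    ∀ r ∈ killingRels (SigmaTable T) (otherBlocks X i), FreeGroup.lift (fun y : Σ i, X i =>
      Pi.mulSingle (M := fun j => PresentedGroup (triangleRels (T j))) y.1
        (PresentedGroup.of y.2) i) r = 1 := by
  refine lift_eq_one_of_mem_killingRels ?_ fun y hy => Pi.mulSingle_eq_of_ne (Ne.symm hy) _
  rintro _ _ _ ⟨h⟩
  rw [← Pi.mul_apply, ← Pi.mulSingle_mul, of_mul_of_eq_of_triangleRels_subset subset_rfl h]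

theorem lift_block_eq_one {i : ι} : ∀ r ∈ triangleRels (T i), FreeGroup.lift (fun x =>
    (PresentedGroup.of ⟨i, x⟩ :
      PresentedGroup (killingRels (SigmaTable T) (otherBlocks X i)))) r = 1 :=
  fun _ => lift_eq_one_of_mem_triangleRels fun _ _ _ h =>
    of_mul_of_eq_of_triangleRels_subset Set.subset_union_left (SigmaTable.mk h)

variable (T) in
open Classical in
/-- Killing the generators outside of the block `i` leaves the group with table `T i`. -/
def presentedGroupSigmaTableEquiv (i : ι) :
    PresentedGroup (killingRels (SigmaTable T) (otherBlocks X i)) ≃*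
      PresentedGroup (triangleRels (T i)) :=
  MonoidHom.toMulEquiv (PresentedGroup.toGroup lift_mulSingle_eq_one)
    (PresentedGroup.toGroup lift_block_eq_one)
    (PresentedGroup.ext fun ⟨j, y⟩ => by
      rw [MonoidHom.comp_apply, PresentedGroup.toGroup.of, MonoidHom.id_apply]
      by_cases h : j = i
      · subst h
        rw [Pi.mulSingle_eq_same, PresentedGroup.toGroup.of]
      · rw [Pi.mulSingle_eq_of_ne (Ne.symm h), map_one, of_eq_one_of_mem _ h])
    (PresentedGroup.ext fun x => by simp [PresentedGroup.toGroup.of])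

end Sigma

end TrianglePresentation

theorem weight_toPath {Q : Type v} [Quiver.{w} Q] {G : Type*} [Monoid G]
    (ω : ∀ {x y : Q}, (x ⟶ y) → G) {x y : Q} (a : x ⟶ y) : a.toPath.weight ω = ω a := by
  rw [Hom.toPath, Path.weight_cons, Path.weight_nil, one_mul]

section PeirceCorner

variable (k : Type*) {B : Type*} [Field k] [Ring B] [Algebra k B]

/-- The Peirce corner `e B e'`, for idempotents `e` and `e'`. -/
def peirceCorner (e e' : B) : Submodule k B where
  carrier := {b | e * b = b ∧ b * e' = b}
  zero_mem' := ⟨mul_zero e, zero_mul e'⟩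
  add_mem' := fun ⟨h, h'⟩ ⟨g, g'⟩ => ⟨by rw [mul_add, h, g], by rw [add_mul, h', g']⟩
  smul_mem' := fun r _ ⟨h, h'⟩ => ⟨by rw [mul_smul_comm, h], by rw [smul_mul_assoc, h']⟩

variable {k}

theorem mem_peirceCorner {e e' b : B} : b ∈ peirceCorner k e e' ↔ e * b = b ∧ b * e' = b := Iff.rfl

theorem mem_peirceCorner_of_isIdempotentElem {e : B} (he : IsIdempotentElem e) :
    e ∈ peirceCorner k e e :=
  ⟨he, he⟩

theorem mul_mem_peirceCorner {e e' e'' b b' : B} (hb : b ∈ peirceCorner k e e')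
    (hb' : b' ∈ peirceCorner k e' e'') : b * b' ∈ peirceCorner k e e'' :=
  ⟨by rw [← mul_assoc, hb.1], by rw [mul_assoc, hb'.2]⟩

variable {ι : Type*} [Fintype ι] [DecidableEq ι]

variable (k ι) in
theorem completeOrthogonalIdempotents_matrix_single :
    CompleteOrthogonalIdempotents fun i : ι => Matrix.single i i (1 : k) where
  idem x := by rw [IsIdempotentElem, Matrix.single_mul_single_same, mul_one]
  ortho _ _ h := by simp [h]
  complete := Matrix.sum_single_one

theorem matrix_single_mem_peirceCorner (i j : ι) (r : k) :
    Matrix.single i j r ∈ peirceCorner k (Matrix.single i i (1 : k)) (Matrix.single j j 1) :=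
  mem_peirceCorner.2 ⟨by simp, by simp⟩

end PeirceCorner

namespace PathAlgebra

section Paths

variable {k : Type u} [Field k] {Q : Type v} [Quiver.{w} Q]

theorem ofPath_comp {x y z : Q} (p : Path x y) (q : Path y z) :
    ofPath k (p.comp q) = ofPath k p * ofPath k q :=
  (ofPath_mul_ofPath p q).symm

theorem ofPath_cons {x y z : Q} (p : Path x y) (a : y ⟶ z) :
    ofPath k (p.cons a) = ofPath k p * ofPath k a.toPath :=
  ofPath_comp p a.toPath

variable [Fintype Q]

variable (k) in
/-- The stationary path `e_x` in the path algebra. -/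
abbrev stationary (x : Q) : PathAlgebra k Q := ofPath k (Path.nil : Path x x)

theorem ofPath_mem_peirceCorner {x y : Q} (p : Path x y) :
    ofPath k p ∈ peirceCorner k (stationary k x) (stationary k y) :=
  ⟨by rw [ofPath_mul_ofPath, Path.nil_comp], by rw [ofPath_mul_ofPath, Path.comp_nil]⟩

variable (k Q) in
theorem completeOrthogonalIdempotents_stationary :
    CompleteOrthogonalIdempotents (stationary k : Q → PathAlgebra k Q) where
  idem _ := (ofPath_mem_peirceCorner Path.nil).1
  ortho _ _ h := ofPath_mul_ofPath_of_ne h _ _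
  complete := one_def.symm

end Paths

section Lift

variable {k : Type u} [Field k] {Q : Type v} [Quiver.{w} Q]
  {B : Type*} [Ring B] [Algebra k B] {e : Q → B} {f : ∀ {x y : Q}, (x ⟶ y) → B}

variable (e f) in
/-- The image of a path under the substitution `f` of arrows, starting from the idempotent
`e x` of its source `x`. -/
def liftPath {x : Q} : ∀ {y : Q}, Path x y → B
  | _, Path.nil => e x
  | _, Path.cons p a => liftPath p * f a

variable (k e f) in
/-- The linear extension of `liftPath`. -/
def liftLinear : PathAlgebra k Q →ₗ[k] B :=
  (basis k Q).constr k fun p => liftPath e f p.2.2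

theorem liftLinear_ofPath {x y : Q} (p : Path x y) :
    liftLinear k e f (ofPath k p) = liftPath e f p :=
  (basis k Q).constr_basis k _ _

variable [Fintype Q] (he : CompleteOrthogonalIdempotents e)
  (hf : ∀ {x y : Q} (a : x ⟶ y), f a ∈ peirceCorner k (e x) (e y))

include he hf

theorem liftPath_mem_peirceCorner {x y : Q} (p : Path x y) :
    liftPath e f p ∈ peirceCorner k (e x) (e y) := by
  induction p with
  | nil => exact mem_peirceCorner_of_isIdempotentElem (he.idem x)
  | cons p a ih => exact mul_mem_peirceCorner ih (hf a)

theorem liftPath_comp {x y z : Q} (p : Path x y) (q : Path y z) :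
    liftPath e f (p.comp q) = liftPath e f p * liftPath e f q := by
  induction q with
  | nil => exact (liftPath_mem_peirceCorner he hf p).2.symm
  | cons q a ih => rw [Path.comp_cons, liftPath, ih, mul_assoc, liftPath]

theorem liftPath_mul_liftPath_of_ne {x y y' z : Q} (h : y ≠ y') (p : Path x y) (q : Path y' z) :
    liftPath e f p * liftPath e f q = 0 := by
  rw [← (liftPath_mem_peirceCorner he hf p).2, ← (liftPath_mem_peirceCorner he hf q).1, mul_assoc,
    ← mul_assoc (e y), he.ortho h, zero_mul, mul_zero]

theorem liftLinear_mul (g h : PathAlgebra k Q) :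
    liftLinear k e f (g * h) = liftLinear k e f g * liftLinear k e f h := by
  refine (liftLinear k e f).map_mul_iff.2
    (lin_ext fun ⟨x, y, p⟩ => lin_ext fun ⟨y', z, q⟩ => ?_) g h
  change liftLinear k e f (ofPath k p * ofPath k q) =
    liftLinear k e f (ofPath k p) * liftLinear k e f (ofPath k q)
  rw [liftLinear_ofPath, liftLinear_ofPath]
  by_cases hy : y = y'
  · subst hy
    rw [ofPath_mul_ofPath, liftLinear_ofPath, liftPath_comp he hf]
  · rw [ofPath_mul_ofPath_of_ne hy, map_zero, liftPath_mul_liftPath_of_ne he hf hy]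

/-- The universal property of the path algebra: a complete family of orthogonal idempotents
indexed by the vertices and elements of the matching Peirce corners indexed by the arrows extend
to an algebra homomorphism. -/
def lift : PathAlgebra k Q →ₐ[k] B :=
  AlgHom.ofLinearMap (liftLinear k e f)
    (by rw [one_def, map_sum, ← he.complete]
        exact Finset.sum_congr rfl fun x _ => liftLinear_ofPath Path.nil)
    (liftLinear_mul he hf)

theorem lift_ofPath {x y : Q} (p : Path x y) : lift he hf (ofPath k p) = liftPath e f p :=
  liftLinear_ofPath p

theorem lift_arrow {x y : Q} (a : x ⟶ y) : lift he hf (ofPath k a.toPath) = f a :=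
  (lift_ofPath he hf _).trans (hf a).1

end Lift

section Applications

variable {k : Type u} [Field k] {Q : Type v} [Quiver.{w} Q] [Fintype Q]

theorem algHom_ext {B : Type*} [Ring B] [Algebra k B] {φ ψ : PathAlgebra k Q →ₐ[k] B}
    (h₀ : ∀ x : Q, φ (stationary k x) = ψ (stationary k x))
    (h₁ : ∀ {x y : Q} (a : x ⟶ y), φ (ofPath k a.toPath) = ψ (ofPath k a.toPath)) : φ = ψ := by
  refine AlgHom.toLinearMap_injective (lin_ext fun ⟨x, y, p⟩ => ?_)
  change φ (ofPath k p) = ψ (ofPath k p)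
  induction p with
  | nil => exact h₀ x
  | cons p a ih => rw [ofPath_cons, map_mul, map_mul, ih, h₁]

section ThinRep

variable [DecidableEq Q]

/-- The thin representation with dimension vector `(1, …, 1)` in which the arrow `a` acts as
multiplication by the scalar `r a`. -/
def thinRep (r : ∀ {x y : Q}, (x ⟶ y) → k) : PathAlgebra k Q →ₐ[k] Matrix Q Q k :=
  lift (completeOrthogonalIdempotents_matrix_single k Q)
    (f := fun {x y} a => Matrix.single x y (r a)) fun _ => matrix_single_mem_peirceCorner _ _ _

theorem thinRep_ofPath (r : ∀ {x y : Q}, (x ⟶ y) → k) {x y : Q} (p : Path x y) :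
    thinRep r (ofPath k p) = Matrix.single x y (p.weight r) := by
  refine (lift_ofPath _ (fun _ => matrix_single_mem_peirceCorner _ _ _) p).trans ?_
  induction p with
  | nil => rw [liftPath, Path.weight_nil]
  | cons p a ih => rw [liftPath, ih, Matrix.single_mul_single_same, Path.weight_cons]

end ThinRep

section WeightCoaction

variable {G : Type*} [Monoid G] (ω : ∀ {x y : Q}, (x ⟶ y) → G)

variable (k Q G) in
theorem completeOrthogonalIdempotents_single_one_stationary :
    CompleteOrthogonalIdempotents fun x : Q => MonoidAlgebra.single (1 : G) (stationary k x) :=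
  (completeOrthogonalIdempotents_stationary k Q).map
    (MonoidAlgebra.singleOneRingHom (R := PathAlgebra k Q) (M := G))

theorem single_ofPath_mem_peirceCorner {x y : Q} (p : Path x y) (g : G) :
    MonoidAlgebra.single g (ofPath k p) ∈ peirceCorner k
      (MonoidAlgebra.single 1 (stationary k x)) (MonoidAlgebra.single 1 (stationary k y)) := by
  obtain ⟨hl, hr⟩ := ofPath_mem_peirceCorner (k := k) p
  exact mem_peirceCorner.2 ⟨by rw [MonoidAlgebra.single_mul_single, one_mul, hl],
    by rw [MonoidAlgebra.single_mul_single, mul_one, hr]⟩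

/-- The coaction of the monoid `G` on the path algebra that records the weight of each path. -/
def weightCoaction : PathAlgebra k Q →ₐ[k] MonoidAlgebra (PathAlgebra k Q) G :=
  lift (completeOrthogonalIdempotents_single_one_stationary k Q G)
    (f := fun a => MonoidAlgebra.single (ω a) (ofPath k a.toPath))
    fun a => single_ofPath_mem_peirceCorner a.toPath (ω a)

theorem weightCoaction_ofPath {x y : Q} (p : Path x y) :
    weightCoaction ω (ofPath k p) = MonoidAlgebra.single (p.weight ω) (ofPath k p) := by
  refine (lift_ofPath _ (fun a => single_ofPath_mem_peirceCorner a.toPath (ω a)) p).trans ?_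
  induction p with
  | nil => rw [liftPath, Path.weight_nil]
  | cons p a ih =>
    rw [liftPath, ih, MonoidAlgebra.single_mul_single, ← ofPath_cons, Path.weight_cons]

variable (k) in
/-- The elements of the path algebra that are combinations of paths of weight `g`. -/
def weightSpace (g : G) : Submodule k (PathAlgebra k Q) where
  carrier := {f | weightCoaction ω f = MonoidAlgebra.single g f}
  zero_mem' := by simp
  add_mem' {f f'} hf hf' := by
    rw [Set.mem_ofPred_eq] at *
    rw [map_add, hf, hf', MonoidAlgebra.single_add]
  smul_mem' r f hf := by
    rw [Set.mem_ofPred_eq] at *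
    rw [map_smul, hf, MonoidAlgebra.smul_single]

variable {ω}

theorem mem_weightSpace {g : G} {f : PathAlgebra k Q} :
    f ∈ weightSpace k ω g ↔ weightCoaction ω f = MonoidAlgebra.single g f :=
  Iff.rfl

theorem mul_mem_weightSpace {g g' : G} {f f' : PathAlgebra k Q} (hf : f ∈ weightSpace k ω g)
    (hf' : f' ∈ weightSpace k ω g') : f * f' ∈ weightSpace k ω (g * g') := by
  rw [mem_weightSpace] at *
  rw [map_mul, hf, hf', MonoidAlgebra.single_mul_single]

theorem ofPath_mem_weightSpace {x y : Q} (p : Path x y) :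
    ofPath k p ∈ weightSpace k ω (p.weight ω) :=
  weightCoaction_ofPath ω p

variable (ω) in
/-- The ideal `I` is graded by the weight `ω`: it contains the component of every weight of each
of its elements. -/
def IsWeightGraded (I : TwoSidedIdeal (PathAlgebra k Q)) : Prop :=
  ∀ f ∈ I, ∀ g, (weightCoaction ω f).coeff g ∈ I

theorem isWeightGraded_span {s : Set (PathAlgebra k Q)} (hs : ∀ f ∈ s, ∃ g, f ∈ weightSpace k ω g) :
    IsWeightGraded ω (TwoSidedIdeal.span s) := by
  -- Modulo the span, the coaction kills the generators, hence the span.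
  let I := TwoSidedIdeal.span s
  let Δ : PathAlgebra k Q →+* MonoidAlgebra I.ringCon.Quotient G :=
    (MonoidAlgebra.mapRingHom G I.ringCon.mk').comp (weightCoaction (k := k) ω).toRingHom
  have hΔ : I ≤ TwoSidedIdeal.ker Δ := by
    refine TwoSidedIdeal.span_le.2 fun f hf => ?_
    obtain ⟨g, hg⟩ := hs f hf
    have hI : I.ringCon.mk' f = 0 := by
      rw [← TwoSidedIdeal.mem_ker, TwoSidedIdeal.ker_ringCon_mk']
      exact TwoSidedIdeal.subset_span hf
    rw [SetLike.mem_coe, TwoSidedIdeal.mem_ker]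
    change MonoidAlgebra.mapRingHom G I.ringCon.mk' (weightCoaction ω f) = 0
    rw [mem_weightSpace.1 hg, MonoidAlgebra.mapRingHom_single, hI, MonoidAlgebra.single_zero]
  intro f hf g
  rw [← TwoSidedIdeal.ker_ringCon_mk' (TwoSidedIdeal.span s), TwoSidedIdeal.mem_ker,
    ← MonoidAlgebra.coeff_mapRingHom]
  exact congrArg (MonoidAlgebra.coeff · g) ((TwoSidedIdeal.mem_ker Δ).1 (hΔ hf))

end WeightCoaction

end Applications

end PathAlgebra

section BoundedLength

theorem finite_setOf_length_lt {Q : Type v} [Quiver.{w} Q] (hQ : IsFiniteQuiver Q) (x : Q) (n : ℕ) :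
    {p : Σ y, Path x y | p.2.length < n}.Finite := by
  obtain ⟨_, _⟩ := hQ
  induction n with
  | zero => simp
  | succ n ih =>
    let extend (p : Σ y, Path x y) (a : Σ z, p.1 ⟶ z) : Σ y, Path x y := ⟨a.1, p.2.cons a.2⟩
    refine ((ih.biUnion fun p _ => Set.finite_range (extend p)).insert ⟨x, Path.nil⟩).subset ?_
    rintro ⟨_, _ | ⟨p, a⟩⟩ hp
    · exact Set.mem_insert _ _
    · have hp : p.length + 1 < n + 1 := hp
      exact Or.inr (Set.mem_biUnion (x := ⟨_, p⟩) (Nat.lt_of_succ_lt_succ hp) ⟨⟨_, a⟩, rfl⟩)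

theorem finite_anyPath_of_length_lt {Q : Type v} [Quiver.{w} Q] (hQ : IsFiniteQuiver Q) {n : ℕ}
    (hn : ∀ {x y : Q} (p : Path x y), p.length < n) : Finite (AnyPath Q) := by
  have := hQ.1
  have (x : Q) : Finite (Σ y, Path x y) := by
    rw [← Set.finite_univ_iff]
    exact (finite_setOf_length_lt hQ x n).subset fun p _ => hn p.2
  infer_instance

namespace PathAlgebra

variable (k : Type u) [Field k] (Q : Type v) [Quiver.{w} Q]

/-- The span of the paths of length at least `n`. -/
def lengthGE (n : ℕ) : Submodule k (PathAlgebra k Q) :=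
  Submodule.span k {f | ∃ (x y : Q) (p : Path x y), n ≤ p.length ∧ ofPath k p = f}

variable {k Q}

theorem mem_lengthGE_zero (f : PathAlgebra k Q) : f ∈ lengthGE k Q 0 := by
  refine Submodule.span_mono ?_ ((basis k Q).mem_span f)
  rintro _ ⟨⟨x, y, p⟩, rfl⟩
  exact ⟨x, y, p, Nat.zero_le _, rfl⟩

theorem lengthGE_eq_bot {n : ℕ} (hn : ∀ {x y : Q} (p : Path x y), p.length < n) :
    lengthGE k Q n = ⊥ := by
  refine Submodule.span_eq_bot.2 ?_
  rintro _ ⟨x, y, p, hp, -⟩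
  exact absurd hp (hn p).not_ge

theorem mul_mem_lengthGE {m n : ℕ} {f g : PathAlgebra k Q} (hf : f ∈ lengthGE k Q m)
    (hg : g ∈ lengthGE k Q n) : f * g ∈ lengthGE k Q (m + n) := by
  have hle : Submodule.map₂ (mulBilin k Q) (lengthGE k Q m) (lengthGE k Q n) ≤
      lengthGE k Q (m + n) := by
    rw [lengthGE, lengthGE, Submodule.map₂_span_span, Submodule.span_le]
    rintro _ ⟨_, ⟨x, y, p, hp, rfl⟩, _, ⟨y', z, q, hq, rfl⟩, rfl⟩
    change ofPath k p * ofPath k q ∈ lengthGE k Q (m + n)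
    by_cases h : y = y'
    · subst h
      rw [ofPath_mul_ofPath]
      exact Submodule.subset_span
        ⟨x, z, p.comp q, (add_le_add hp hq).trans_eq (Path.length_comp p q).symm, rfl⟩
    · rw [ofPath_mul_ofPath_of_ne h]
      exact zero_mem _
  exact hle (Submodule.apply_mem_map₂ _ hf hg)

variable [Fintype Q]

theorem mem_lengthGE_one_of_mem_arrowIdeal {f : PathAlgebra k Q} (hf : f ∈ arrowIdeal k Q) :
    f ∈ lengthGE k Q 1 := by
  let J : TwoSidedIdeal (PathAlgebra k Q) := TwoSidedIdeal.mk' (lengthGE k Q 1)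
    (zero_mem _) (add_mem · ·) (neg_mem ·)
    (fun {g _} h => by
      simpa only [zero_add, SetLike.mem_coe] using mul_mem_lengthGE (mem_lengthGE_zero g) h)
    (fun {_ g} h => by
      simpa only [add_zero, SetLike.mem_coe] using mul_mem_lengthGE h (mem_lengthGE_zero g))
  have hJ : arrowIdeal k Q ≤ J := by
    refine TwoSidedIdeal.span_le.2 ?_
    rintro _ ⟨x, y, a, rfl⟩
    exact (TwoSidedIdeal.mem_mk' _ _ _ _ _ _ _).2
      (Submodule.subset_span ⟨x, y, a.toPath, le_rfl, rfl⟩)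
  exact (TwoSidedIdeal.mem_mk' _ _ _ _ _ _ _).1 (hJ hf)

theorem mem_lengthGE_of_mem_arrowIdeal_pow {n : ℕ} {f : PathAlgebra k Q}
    (hf : f ∈ (arrowIdeal k Q).asIdeal ^ n) : f ∈ lengthGE k Q n := by
  induction n generalizing f with
  | zero => exact mem_lengthGE_zero f
  | succ n ih =>
    rw [Submodule.pow_succ] at hf
    refine Submodule.mul_induction_on hf (fun g hg h hh => ?_) fun _ _ => add_mem
    exact mul_mem_lengthGE (ih hg) (mem_lengthGE_one_of_mem_arrowIdeal hh)

theorem arrowIdeal_pow_eq_bot {n : ℕ} (hn : ∀ {x y : Q} (p : Path x y), p.length < n) :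
    (arrowIdeal k Q).asIdeal ^ n = ⊥ :=
  le_bot_iff.1 fun _ hf => (lengthGE_eq_bot (k := k) hn).le (mem_lengthGE_of_mem_arrowIdeal_pow hf)

theorem isAdmissible_span {n : ℕ} (h2 : 2 ≤ n) (hn : ∀ {x y : Q} (p : Path x y), p.length < n)
    {s : Set (PathAlgebra k Q)} (hs : ∀ f ∈ s, f ∈ (arrowIdeal k Q).asIdeal ^ 2) :
    IsAdmissible (TwoSidedIdeal.span s) := by
  refine ⟨n, h2, (arrowIdeal_pow_eq_bot hn).trans_le bot_le, ?_⟩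
  have hle : TwoSidedIdeal.span s ≤ ((arrowIdeal k Q).asIdeal ^ 2).toTwoSided :=
    TwoSidedIdeal.span_le.2 fun f hf => Ideal.mem_toTwoSided.2 (hs f hf)
  exact fun f hf => Ideal.mem_toTwoSided.1 (hle hf)

theorem ofPath_mem_arrowIdeal {x y : Q} (a : x ⟶ y) :
    ofPath k a.toPath ∈ (arrowIdeal k Q).asIdeal :=
  TwoSidedIdeal.subset_span ⟨x, y, a, rfl⟩

theorem finiteDimensional_quotient (hQ : Finite (AnyPath Q)) (I : Ideal (PathAlgebra k Q))
    [I.IsTwoSided] : FiniteDimensional k (PathAlgebra k Q ⧸ I) := by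
  have := Module.Finite.of_basis (basis k Q)
  exact Module.Finite.of_surjective (Ideal.Quotient.mkₐ k I).toLinearMap
    (Ideal.Quotient.mkₐ_surjective k I)

end PathAlgebra

end BoundedLength

section Shear

namespace PathAlgebra

variable {k : Type u} [Field k] {Q : Type v} [Quiver.{w} Q]

/-- The arrow `a` minus the multiple `s a` of the parallel arrow `base a`. -/
def sheared (base : ∀ {x y : Q}, (x ⟶ y) → (x ⟶ y)) (s : ∀ {x y : Q}, (x ⟶ y) → k) {x y : Q}
    (a : x ⟶ y) : PathAlgebra k Q :=
  ofPath k a.toPath - s a • ofPath k (base a).toPath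

variable {base : ∀ {x y : Q}, (x ⟶ y) → (x ⟶ y)} {s t : ∀ {x y : Q}, (x ⟶ y) → k} {x y : Q}

theorem sheared_of_eq_zero {a : x ⟶ y} (ha : s a = 0) : sheared base s a = ofPath k a.toPath := by
  rw [sheared, ha, zero_smul, sub_zero]

variable [Fintype Q]

theorem sheared_mem_peirceCorner (a : x ⟶ y) :
    sheared base s a ∈ peirceCorner k (stationary k x) (stationary k y) :=
  sub_mem (ofPath_mem_peirceCorner _) (Submodule.smul_mem _ _ (ofPath_mem_peirceCorner _))

theorem sheared_mem_arrowIdeal (a : x ⟶ y) :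
    sheared base s a ∈ (arrowIdeal k Q).asIdeal :=
  sub_mem (ofPath_mem_arrowIdeal a)
    (Submodule.smul_of_tower_mem _ (s a) (ofPath_mem_arrowIdeal (base a)))

theorem sheared_mem_weightSpace {G : Type*} [Monoid G] {ω : ∀ {x y : Q}, (x ⟶ y) → G} {a : x ⟶ y}
    (h : s a = 0 ∨ ω (base a) = ω a) : sheared base s a ∈ weightSpace k ω (ω a) := by
  have harrow (b : x ⟶ y) : ofPath k b.toPath ∈ weightSpace k ω (ω b) := by
    simpa only [weight_toPath] using ofPath_mem_weightSpace (k := k) (ω := ω) b.toPath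
  obtain h | h := h
  · rw [sheared_of_eq_zero h]
    exact harrow a
  · exact sub_mem (harrow a) (Submodule.smul_mem _ _ (h ▸ harrow (base a)))

theorem thinRep_sheared [DecidableEq Q] (r : ∀ {x y : Q}, (x ⟶ y) → k) (a : x ⟶ y) :
    thinRep r (sheared base s a) = Matrix.single x y (r a - s a * r (base a)) := by
  rw [sheared, map_sub, map_smul, thinRep_ofPath, thinRep_ofPath, weight_toPath, weight_toPath,
    Matrix.smul_single, smul_eq_mul]
  exact (map_sub (Matrix.singleAddMonoidHom (α := k) x y) _ _).symm

variable (base s) in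
/-- The endomorphism that sends each arrow `a` to `sheared base s a`. -/
def shear : PathAlgebra k Q →ₐ[k] PathAlgebra k Q :=
  lift (completeOrthogonalIdempotents_stationary k Q) (f := sheared base s)
    sheared_mem_peirceCorner

theorem shear_stationary (x : Q) : shear base s (stationary k x) = stationary k x :=
  lift_ofPath _ sheared_mem_peirceCorner _

theorem shear_ofPath_toPath (a : x ⟶ y) :
    shear base s (ofPath k a.toPath) = sheared base s a :=
  lift_arrow _ sheared_mem_peirceCorner a

theorem shear_sheared (hs : ∀ {x y : Q} (a : x ⟶ y), s (base a) = 0) (a : x ⟶ y) :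
    shear base s (sheared base t a) = sheared base (fun b => s b + t b) a := by
  rw [sheared, map_sub, map_smul, shear_ofPath_toPath, shear_ofPath_toPath,
    sheared_of_eq_zero (hs a), sheared, sheared, sub_sub, ← add_smul]

theorem shear_comp_shear (hs : ∀ {x y : Q} (a : x ⟶ y), s (base a) = 0)
    (hst : ∀ {x y : Q} (a : x ⟶ y), s a + t a = 0) :
    (shear base s).comp (shear base t) = AlgHom.id k (PathAlgebra k Q) := by
  refine algHom_ext (fun x => ?_) fun a => ?_
  · simp only [AlgHom.comp_apply, shear_stationary, AlgHom.id_apply]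
  · rw [AlgHom.comp_apply, shear_ofPath_toPath, shear_sheared hs, sheared_of_eq_zero (hst a),
      AlgHom.id_apply]

end PathAlgebra

end Shear

section WalkWeight

variable {Q : Type v} [Quiver.{w} Q] {G : Type*} [Group G] (ω : ∀ {x y : Q}, (x ⟶ y) → G)

/-- The weight of an arrow or of the formal inverse of an arrow. -/
def symmetrifyWeight {x y : Symmetrify Q} : (x ⟶ y) → G :=
  Sum.elim ω fun a => (ω a)⁻¹

/-- The weight of a walk, in which the formal inverse of an arrow has the inverse weight. -/
abbrev walkWeight {x y : Symmetrify Q} (p : Walk x y) : G :=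
  p.weight (symmetrifyWeight ω)

theorem symmetrifyWeight_reverse {x y : Symmetrify Q} (e : x ⟶ y) :
    symmetrifyWeight ω (Quiver.reverse e) = (symmetrifyWeight ω e)⁻¹ := by
  rcases e with a | a
  · rfl
  · exact (inv_inv (ω a)).symm

theorem walkWeight_reverse {x y : Symmetrify Q} (p : Walk x y) :
    walkWeight ω p.reverse = (walkWeight ω p)⁻¹ := by
  induction p with
  | nil => rw [Path.reverse, walkWeight, Path.weight_nil, inv_one]
  | cons p e ih =>
    simp only [walkWeight] at *
    rw [Path.reverse, Path.weight_comp, ih, weight_toPath, symmetrifyWeight_reverse,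
      Path.weight_cons, mul_inv_rev]

theorem walkWeight_toWalk {x y : Q} (p : Path x y) : walkWeight ω (toWalk p) = p.weight ω := by
  induction p with
  | nil => exact (Path.weight_nil _ _).trans (Path.weight_nil _ _).symm
  | cons p a ih =>
    rw [Path.weight_cons, ← ih]
    exact Path.weight_cons _ (toWalk p) (Sum.inl a)

end WalkWeight

section Homotopy

variable {k : Type u} [Field k] {Q : Type v} [Quiver.{w} Q] [Fintype Q]
  {I : TwoSidedIdeal (PathAlgebra k Q)} {G : Type*} [Group G] {ω : ∀ {x y : Q}, (x ⟶ y) → G}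

theorem Homotopic.of_sub_mem {x y : Q} {p q : Path x y}
    (h : PathAlgebra.ofPath k p - PathAlgebra.ofPath k q ∈ I) (hp : PathAlgebra.ofPath k p ∉ I) :
    Homotopic I (toWalk p) (toWalk q) := by
  classical
  by_cases hpq : p = q
  · exact hpq ▸ Homotopic.refl _
  have hq : PathAlgebra.ofPath k q ∉ I := fun hq => hp (by simpa using I.add_mem h hq)
  refine Homotopic.relation (S := {p, q}) (c := fun r => if r = p then 1 else -1)
    ⟨(Finset.card_pair hpq).ge, fun r _ => ?_, ?_, fun J hJ hne => ?_⟩ (by simp) (by simp)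
  · split_ifs <;> simp
  · rw [Finset.sum_pair hpq]
    simpa [Ne.symm hpq, sub_eq_add_neg] using h
  · obtain rfl | rfl : J = {p} ∨ J = {q} := by grind
    · simpa using hp
    · simpa [Ne.symm hpq] using hq

theorem IsMinimalRelation.weight_eq (hI : PathAlgebra.IsWeightGraded ω I) {x y : Q}
    {S : Finset (Path x y)} {c : Path x y → k} (h : IsMinimalRelation I S c) {p q : Path x y}
    (hp : p ∈ S) (hq : q ∈ S) : p.weight ω = q.weight ω := by
  classical
  by_contra hne
  refine h.minimal (S.filter fun r => r.weight ω = q.weight ω)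
    (Finset.filter_ssubset.2 ⟨p, hp, hne⟩) ⟨q, Finset.mem_filter.2 ⟨hq, rfl⟩⟩ ?_
  have hcomponent := hI _ h.mem (q.weight ω)
  simpa [PathAlgebra.weightCoaction_ofPath, Finsupp.single_apply, Finset.sum_filter]
    using hcomponent

theorem Homotopic.walkWeight_eq (hI : PathAlgebra.IsWeightGraded ω I) {x y : Symmetrify Q}
    {p q : Walk x y} (h : Homotopic I p q) : walkWeight ω p = walkWeight ω q := by
  induction h with
  | refl => rfl
  | symm _ ih => exact ih.symm
  | trans _ _ ih ih' => exact ih.trans ih'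
  | cancel e =>
    rw [walkWeight, Path.weight_comp, weight_toPath, weight_toPath,
      symmetrifyWeight_reverse, mul_inv_cancel, walkWeight, Path.weight_nil]
  | relation h hp hq => rw [walkWeight_toWalk, walkWeight_toWalk, h.weight_eq hI hp hq]
  | comp p r _ ih => simp only [walkWeight, Path.weight_comp, ih]

/-- The homomorphism from the fundamental group given by a weight for which the ideal is graded. -/
def weightHom (hI : PathAlgebra.IsWeightGraded ω I) (v₀ : Q) : FundamentalGroup I v₀ →* G where
  toFun := Quotient.lift (walkWeight ω) fun _ _ => Homotopic.walkWeight_eq hI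
  map_one' := Path.weight_nil _ _
  map_mul' := by
    rintro ⟨p⟩ ⟨q⟩
    exact Path.weight_comp _ p q

end Homotopy

section FundamentalGroupoid

open CategoryTheory

variable {k : Type u} [Field k] {Q : Type v} [Quiver.{w} Q] [Fintype Q]

/-- The fundamental groupoid of `(Q, I)`: its objects are the vertices of `Q`, its morphisms the
homotopy classes of walks. -/
structure FundamentalGroupoid (I : TwoSidedIdeal (PathAlgebra k Q)) : Type v where
  vertex : Symmetrify Q

variable (I : TwoSidedIdeal (PathAlgebra k Q))

/-- Homotopy of walks from `x` to `y`. -/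
def walkSetoid (x y : Symmetrify Q) : Setoid (Walk x y) where
  r := Homotopic I
  iseqv := ⟨Homotopic.refl, Homotopic.symm, Homotopic.trans⟩

instance : Groupoid (FundamentalGroupoid I) where
  Hom x y := Quotient (walkSetoid I x.vertex y.vertex)
  id x := Quotient.mk (walkSetoid I x.vertex x.vertex) Path.nil
  comp := Quotient.map₂ (fun p q => Path.comp p q)
    fun _ p' hp q _ hq => (Homotopic.comp_right hp q).trans (Homotopic.comp_left p' hq)
  inv := Quotient.map (fun p => Path.reverse p) fun _ _ => Homotopic.reverse
  id_comp := by
    rintro x y ⟨p⟩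
    exact congrArg (Quotient.mk (walkSetoid I x.vertex y.vertex)) (Path.nil_comp p)
  comp_id := by
    rintro x y ⟨p⟩
    exact congrArg (Quotient.mk (walkSetoid I x.vertex y.vertex)) (Path.comp_nil p)
  assoc := by
    rintro x _ _ y ⟨p⟩ ⟨q⟩ ⟨r⟩
    exact congrArg (Quotient.mk (walkSetoid I x.vertex y.vertex)) (Path.comp_assoc p q r)
  inv_comp := by
    rintro x y ⟨p⟩
    exact Quotient.sound (s := walkSetoid I y.vertex y.vertex) (Homotopic.reverse_comp p)
  comp_inv := by
    rintro x y ⟨p⟩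
    exact Quotient.sound (s := walkSetoid I x.vertex x.vertex) (Homotopic.comp_reverse p)

/-- The homotopy class of a walk, as a morphism of the fundamental groupoid. -/
def walkClass {x y : Symmetrify Q} (p : Walk x y) :
    (⟨x⟩ : FundamentalGroupoid I) ⟶ ⟨y⟩ :=
  Quotient.mk (walkSetoid I x y) p

variable {I}

theorem Homotopic.walkClass_eq {x y : Symmetrify Q} {p q : Walk x y} (h : Homotopic I p q) :
    walkClass I p = walkClass I q :=
  Quotient.sound (s := walkSetoid I x y) h

theorem walkClass_comp {x y z : Symmetrify Q} (p : Walk x y) (q : Walk y z) :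
    walkClass I (p.comp q) = walkClass I p ≫ walkClass I q :=
  rfl

variable (I) in
/-- The transport of the fundamental group along a walk. -/
def fundamentalGroupEquivOfWalk {v₀ v₁ : Q}
    (p : Walk (Symmetrify.of.obj v₀) (Symmetrify.of.obj v₁)) :
    FundamentalGroup I v₀ ≃* FundamentalGroup I v₁ :=
  Groupoid.vertexGroupIsomOfMap (walkClass I p)

section Loop

variable {v₀ : Q} (t : ∀ x : Symmetrify Q, Walk (Symmetrify.of.obj v₀) x)

variable (I) in
/-- The class of the closed walk obtained from a walk `p` by joining its end points to the base
point by the walks `t`. -/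
def loopClass {x y : Symmetrify Q} (p : Walk x y) : FundamentalGroup I v₀ :=
  walkClass I (t x) ≫ walkClass I p ≫ Groupoid.inv (walkClass I (t y))

theorem Homotopic.loopClass_eq {x y : Symmetrify Q} {p q : Walk x y} (h : Homotopic I p q) :
    loopClass I t p = loopClass I t q := by
  rw [loopClass, h.walkClass_eq, loopClass]

theorem loopClass_nil (x : Symmetrify Q) : loopClass I t (Path.nil : Walk x x) = 1 :=
  (congrArg _ (Category.id_comp _)).trans (Groupoid.comp_inv _)

theorem loopClass_comp {x y z : Symmetrify Q} (p : Walk x y) (q : Walk y z) :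
    loopClass I t (p.comp q) = loopClass I t p * loopClass I t q := by
  change walkClass I (t x) ≫ (walkClass I p ≫ walkClass I q) ≫ Groupoid.inv (walkClass I (t z)) =
    (walkClass I (t x) ≫ walkClass I p ≫ Groupoid.inv (walkClass I (t y))) ≫
      (walkClass I (t y) ≫ walkClass I q ≫ Groupoid.inv (walkClass I (t z)))
  simp

theorem loopClass_toWalk_comp {x y z : Q} (p : Path x y) (q : Path y z) :
    loopClass I t (toWalk (p.comp q)) = loopClass I t (toWalk p) * loopClass I t (toWalk q) := by
  rw [toWalk, Prefunctor.mapPath_comp]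
  exact loopClass_comp t (toWalk p) (toWalk q)

theorem loopClass_reverse {x y : Symmetrify Q} (p : Walk x y) :
    loopClass I t p.reverse = (loopClass I t p)⁻¹ := by
  rw [eq_inv_iff_mul_eq_one, ← loopClass_comp, (Homotopic.reverse_comp p).loopClass_eq,
    loopClass_nil]

theorem loopClass_eq_one_of_comp_eq {x y : Symmetrify Q} {p : Walk x y} (h : (t x).comp p = t y) :
    loopClass I t p = 1 := by
  rw [loopClass, ← Category.assoc, ← walkClass_comp, h]
  exact Groupoid.comp_inv _

theorem loopClass_of_nil (ht : t (Symmetrify.of.obj v₀) = Path.nil)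
    (p : Walk (Symmetrify.of.obj v₀) (Symmetrify.of.obj v₀)) :
    loopClass I t p = Quotient.mk (homotopySetoid I (Symmetrify.of.obj v₀)) p := by
  rw [loopClass, ht]
  exact congrArg (Quotient.mk (homotopySetoid I (Symmetrify.of.obj v₀))) (Path.nil_comp p)

variable {t} {G : Type*} [Group G] {ω : ∀ {x y : Q}, (x ⟶ y) → G}
  {φ : G →* FundamentalGroup I v₀}

theorem weightHom_loopClass (hI : PathAlgebra.IsWeightGraded ω I) {x y : Symmetrify Q}
    (p : Walk x y) : weightHom hI v₀ (loopClass I t p) =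
      walkWeight ω (t x) * walkWeight ω p * (walkWeight ω (t y))⁻¹ := by
  change walkWeight ω ((t x).comp (p.comp (t y).reverse)) = _
  rw [walkWeight, Path.weight_comp, Path.weight_comp, ← mul_assoc, ← walkWeight_reverse]

theorem map_walkWeight (hφ : ∀ {x y : Q} (a : x ⟶ y), φ (ω a) = loopClass I t (toWalk a.toPath))
    {x y : Symmetrify Q} (p : Walk x y) : φ (walkWeight ω p) = loopClass I t p := by
  have hedge {x y : Symmetrify Q} (e : x ⟶ y) :
      φ (symmetrifyWeight ω e) = loopClass I t e.toPath := by
    rcases e with a | a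
    · exact hφ a
    · exact (map_inv φ _).trans
        ((congrArg _ (hφ a)).trans (loopClass_reverse t (toWalk a.toPath)).symm)
  induction p with
  | nil => rw [walkWeight, Path.weight_nil, map_one, loopClass_nil]
  | cons p e ih =>
    rw [walkWeight, Path.weight_cons, map_mul, ih, hedge, ← loopClass_comp,
      Path.comp_toPath_eq_cons]

/-- A weight with values in `G` identifies the fundamental group with `G` if the walks `t` have the
weight `1` and the classes of the arrows are the images of their weights under a homomorphism. -/
def fundamentalGroupEquivOfWeight (hI : PathAlgebra.IsWeightGraded ω I)
    (hω : Subgroup.closure {g | ∃ (x y : Q) (a : x ⟶ y), ω a = g} = ⊤)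
    (ht : t (Symmetrify.of.obj v₀) = Path.nil) (htω : ∀ x, walkWeight ω (t x) = 1)
    (hφ : ∀ {x y : Q} (a : x ⟶ y), φ (ω a) = loopClass I t (toWalk a.toPath)) :
    FundamentalGroup I v₀ ≃* G :=
  MonoidHom.toMulEquiv (weightHom hI v₀) φ
    (by
      ext ⟨p⟩
      exact (map_walkWeight (t := t) hφ p).trans (loopClass_of_nil t ht p))
    (by
      refine MonoidHom.eq_of_eqOn_dense hω ?_
      rintro _ ⟨x, y, a, rfl⟩
      rw [MonoidHom.comp_apply, hφ]
      rw [weightHom_loopClass, htω, htω, walkWeight_toWalk, weight_toPath, one_mul,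
        inv_one, mul_one, MonoidHom.id_apply])

end Loop

end FundamentalGroupoid

/-- The vertices of the quiver with arrows `a x : source ⟶ middle` and `b x : middle ⟶ sink` for
`x : Option Y` and arrows `c y : middle ⟶ tip y` for `y : Y`. -/
inductive Vertex (Y : Type*) : Type _
  | source : Vertex Y
  | middle : Vertex Y
  | sink : Vertex Y
  | tip (y : Y) : Vertex Y

/-- The arrows between the vertices `Vertex Y`. The index `none` stands for the trivial element of
the groups to be realized, the index `some y` for the generator `y`. -/
inductive Arrow (Y : Type*) : Vertex Y → Vertex Y → Type _
  | a (x : Option Y) : Arrow Y Vertex.source Vertex.middle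
  | b (x : Option Y) : Arrow Y Vertex.middle Vertex.sink
  | c (y : Y) : Arrow Y Vertex.middle (Vertex.tip y)

namespace Vertex

section Quiver

variable {Y : Type*}

instance : Quiver (Vertex Y) := ⟨Arrow Y⟩

instance [Finite Y] : Finite (Vertex Y) :=
  Finite.of_injective (β := Option (Option (Option Y)))
    (fun
      | source => none
      | middle => some none
      | sink => some (some none)
      | tip y => some (some (some y)))
    fun v v' h => by cases v <;> cases v' <;> simp_all

instance [Finite Y] : Fintype (Vertex Y) := Fintype.ofFinite _

/-- `Arrow.a x` as a morphism of the quiver. -/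
def arrowA (x : Option Y) : (source : Vertex Y) ⟶ middle := Arrow.a x

/-- `Arrow.b x` as a morphism of the quiver. -/
def arrowB (x : Option Y) : (middle : Vertex Y) ⟶ sink := Arrow.b x

/-- `Arrow.c y` as a morphism of the quiver. -/
def arrowC (y : Y) : (middle : Vertex Y) ⟶ tip y := Arrow.c y

theorem isFiniteQuiver [Finite Y] : IsFiniteQuiver (Vertex Y) := by
  refine ⟨inferInstance, fun x y => ?_⟩
  refine Finite.of_injective (β := Option (Option Y)) (fun e : Arrow Y x y => match e with
    | Arrow.a x => some x
    | Arrow.b x => some x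
    | Arrow.c _ => none) ?_
  rintro (x | x | y) (x' | x' | y') h <;> simp_all

/-- The distance of a vertex from the source. -/
def level : Vertex Y → ℕ
  | source => 0
  | middle => 1
  | sink => 2
  | tip _ => 2

theorem level_add_length {x y : Vertex Y} (p : Path x y) : level x + p.length = level y := by
  induction p with
  | nil => rfl
  | cons p e ih =>
    rw [Path.length_cons, ← add_assoc, ih]
    rcases e <;> rfl

theorem length_lt_three {x y : Vertex Y} (p : Path x y) : p.length < 3 := by
  have hlevel := level_add_length p
  have : level y ≤ 2 := by cases y <;> simp [level]
  omega

theorem finite_anyPath [Finite Y] : Finite (AnyPath (Vertex Y)) :=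
  finite_anyPath_of_length_lt isFiniteQuiver length_lt_three

/-- The path `a x` followed by `b y`. -/
def pathAB (x y : Option Y) : Path (source : Vertex Y) sink :=
  (arrowA x).toPath.comp (arrowB y).toPath

/-- The path `a x` followed by `c y`. -/
def pathAC (x : Option Y) (y : Y) : Path (source : Vertex Y) (tip y) :=
  (arrowA x).toPath.comp (arrowC y).toPath

/-- The walks from the source in the spanning tree formed by `a none`, `b none` and the `c y`. -/
def treeWalk : ∀ v : Symmetrify (Vertex Y), Walk (Symmetrify.of.obj (source : Vertex Y)) v
  | source => Path.nil
  | middle => toWalk (arrowA none).toPath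
  | sink => toWalk (pathAB none none)
  | tip y => toWalk (pathAC none y)

theorem isConnectedQuiver : IsConnectedQuiver (Vertex Y) :=
  ⟨⟨source⟩, fun x y => ⟨(treeWalk x).reverse.comp (treeWalk y)⟩⟩

/-- The arrow with index `none` parallel to a given arrow `a x` or `b x`; each arrow `c y` has
no other parallel arrow. -/
def baseArrow : ∀ {x y : Vertex Y}, (x ⟶ y) → (x ⟶ y)
  | _, _, Arrow.a _ => arrowA none
  | _, _, Arrow.b _ => arrowB none
  | _, _, Arrow.c y => arrowC y

end Quiver

section ShearCoeff

variable {k : Type u} [Field k] {Y : Type*}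

/-- The coefficient `s y` of both `a (some y)` and `b (some y)`. -/
def shearCoeff (s : Y → k) : ∀ {x y : Vertex Y}, (x ⟶ y) → k
  | _, _, Arrow.a x => x.elim 0 s
  | _, _, Arrow.b x => x.elim 0 s
  | _, _, Arrow.c _ => 0

theorem shearCoeff_baseArrow (s : Y → k) {x y : Vertex Y} (e : x ⟶ y) :
    shearCoeff s (baseArrow e) = 0 := by
  rcases e <;> rfl

theorem shearCoeff_add (s t : Y → k) {x y : Vertex Y} (e : x ⟶ y) :
    shearCoeff (s + t) e = shearCoeff s e + shearCoeff t e := by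
  obtain x | x | y := e
  · cases x <;> simp [shearCoeff]
  · cases x <;> simp [shearCoeff]
  · simp [shearCoeff]

theorem shearCoeff_zero {x y : Vertex Y} (e : x ⟶ y) : shearCoeff (0 : Y → k) e = 0 := by
  obtain x | x | y := e
  · cases x <;> rfl
  · cases x <;> rfl
  · rfl

theorem shearCoeff_add_eq_zero {s t : Y → k} (h : s + t = 0) {x y : Vertex Y} (e : x ⟶ y) :
    shearCoeff s e + shearCoeff t e = 0 := by
  rw [← shearCoeff_add, h, shearCoeff_zero]

end ShearCoeff

section RelatorIdeal

open PathAlgebra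

variable {k : Type u} [Field k] {Y : Type*}

/-- The arrow `e` minus the multiple prescribed by `s` of the arrow `baseArrow e`. -/
abbrev shearedArrow (s : Y → k) {x y : Vertex Y} (e : x ⟶ y) : PathAlgebra k (Vertex Y) :=
  sheared baseArrow (shearCoeff s) e

theorem shearedArrow_arrowA_none (s : Y → k) :
    shearedArrow s (arrowA none) = ofPath k (arrowA none).toPath :=
  sheared_of_eq_zero rfl

theorem shearedArrow_arrowA_some (s : Y → k) (y : Y) : shearedArrow s (arrowA (some y)) =
    ofPath k (arrowA (some y)).toPath - s y • ofPath k (arrowA none).toPath :=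
  rfl

theorem shearedArrow_arrowB_none (s : Y → k) :
    shearedArrow s (arrowB none) = ofPath k (arrowB none).toPath :=
  sheared_of_eq_zero rfl

theorem shearedArrow_arrowB_some (s : Y → k) (y : Y) : shearedArrow s (arrowB (some y)) =
    ofPath k (arrowB (some y)).toPath - s y • ofPath k (arrowB none).toPath :=
  rfl

theorem shearedArrow_arrowC (s : Y → k) (y : Y) :
    shearedArrow s (arrowC y) = ofPath k (arrowC y).toPath :=
  sheared_of_eq_zero rfl

variable [Finite Y]

/-- The generators of the ideal that encodes the table `T`, in the sheared arrows. -/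
inductive IsRelator (T : Y → Y → Y → Prop) (s : Y → k) : PathAlgebra k (Vertex Y) → Prop
  | comm (y : Y) : IsRelator T s
      (shearedArrow s (arrowA (some y)) * shearedArrow s (arrowB none) -
        shearedArrow s (arrowA none) * shearedArrow s (arrowB (some y)))
  | mul {x y z : Y} (h : T x y z) : IsRelator T s
      (shearedArrow s (arrowA (some x)) * shearedArrow s (arrowB (some y)) -
        shearedArrow s (arrowA (some z)) * shearedArrow s (arrowB none))
  | tip (y : Y) : IsRelator T s (shearedArrow s (arrowA (some y)) * shearedArrow s (arrowC y))

/-- The ideal of the path algebra generated by the relators. -/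
def relatorIdeal (T : Y → Y → Y → Prop) (s : Y → k) : TwoSidedIdeal (PathAlgebra k (Vertex Y)) :=
  TwoSidedIdeal.span {f | IsRelator T s f}

variable {T : Y → Y → Y → Prop} {s : Y → k} {f : PathAlgebra k (Vertex Y)}

theorem IsRelator.mem_relatorIdeal (hf : IsRelator T s f) : f ∈ relatorIdeal T s :=
  TwoSidedIdeal.subset_span hf

theorem IsRelator.mem_arrowIdeal_sq (hf : IsRelator T s f) :
    f ∈ (arrowIdeal k (Vertex Y)).asIdeal ^ 2 := by
  have hmul {x y z : Vertex Y} (e : x ⟶ y) (e' : y ⟶ z) :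
      shearedArrow s e * shearedArrow s e' ∈ (arrowIdeal k (Vertex Y)).asIdeal ^ 2 := by
    rw [Submodule.pow_succ, Submodule.pow_one]
    exact Ideal.mul_mem_mul (sheared_mem_arrowIdeal e) (sheared_mem_arrowIdeal e')
  cases hf with
  | comm y => exact sub_mem (hmul _ _) (hmul _ _)
  | mul h => exact sub_mem (hmul _ _) (hmul _ _)
  | tip y => exact hmul _ _

theorem isAdmissible_relatorIdeal (T : Y → Y → Y → Prop) (s : Y → k) :
    IsAdmissible (relatorIdeal T s) :=
  isAdmissible_span (Nat.le_succ 2) length_lt_three fun _ => IsRelator.mem_arrowIdeal_sq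

theorem shear_shearedArrow (s t : Y → k) {x y : Vertex Y} (e : x ⟶ y) :
    shear baseArrow (shearCoeff s) (shearedArrow t e) = shearedArrow (s + t) e := by
  rw [shear_sheared (shearCoeff_baseArrow s), shearedArrow, sheared, sheared, shearCoeff_add]

theorem IsRelator.shear (s : Y → k) {t : Y → k} (hf : IsRelator T t f) :
    IsRelator T (s + t) (shear baseArrow (shearCoeff s) f) := by
  cases hf with
  | comm y => simpa only [map_sub, map_mul, shear_shearedArrow] using IsRelator.comm y
  | mul h => simpa only [map_sub, map_mul, shear_shearedArrow] using IsRelator.mul h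
  | tip y => simpa only [map_mul, shear_shearedArrow] using IsRelator.tip y

theorem shear_mem_relatorIdeal (s : Y → k) {t : Y → k} (hf : f ∈ relatorIdeal T t) :
    shear baseArrow (shearCoeff s) f ∈ relatorIdeal T (s + t) := by
  have hle : relatorIdeal T t ≤
      (relatorIdeal T (s + t)).comap (PathAlgebra.shear baseArrow (shearCoeff s)) :=
    TwoSidedIdeal.span_le.2 fun _ hg => (TwoSidedIdeal.mem_comap _).2 (hg.shear s).mem_relatorIdeal
  exact (TwoSidedIdeal.mem_comap _).1 (hle hf)

/-- The automorphism of the path algebra that replaces the arrows by the sheared arrows. -/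
def shearEquiv (s : Y → k) : PathAlgebra k (Vertex Y) ≃ₐ[k] PathAlgebra k (Vertex Y) :=
  AlgEquiv.ofAlgHom (shear baseArrow (shearCoeff s)) (shear baseArrow (shearCoeff (-s)))
    (shear_comp_shear (shearCoeff_baseArrow s) (shearCoeff_add_eq_zero (add_neg_cancel s)))
    (shear_comp_shear (shearCoeff_baseArrow (-s)) (shearCoeff_add_eq_zero (neg_add_cancel s)))

theorem relatorIdeal_eq_map_shearEquiv (T : Y → Y → Y → Prop) (s : Y → k) :
    (relatorIdeal T s).asIdeal = (relatorIdeal T 0).asIdeal.map (shearEquiv s) := by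
  refine le_antisymm (fun f hf => ?_) (Ideal.map_le_iff_le_comap.2 fun f hf => ?_)
  · have hmem := shear_mem_relatorIdeal (-s) hf
    rw [neg_add_cancel] at hmem
    rw [← (shearEquiv s).apply_symm_apply f]
    exact Ideal.mem_map_of_mem _ hmem
  · have hmem := shear_mem_relatorIdeal s hf
    rwa [add_zero] at hmem

theorem isPresentation_relatorIdeal (T : Y → Y → Y → Prop) (s : Y → k) :
    IsPresentation (PathAlgebra k (Vertex Y) ⧸ (relatorIdeal T (0 : Y → k)).asIdeal)
      (relatorIdeal T s) where
  finite := isFiniteQuiver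
  connected := isConnectedQuiver
  admissible := isAdmissible_relatorIdeal T s
  iso := ⟨Ideal.quotientEquivAlg _ _ (shearEquiv s) (relatorIdeal_eq_map_shearEquiv T s)⟩

end RelatorIdeal

section KilledGenerators

open PathAlgebra

variable {k : Type u} [Field k] {Y : Type*} [Finite Y] {T : Y → Y → Y → Prop} {S : Set Y}

variable (k T S) in
/-- The ideal that kills the generators in `S`: shearing `a y` and `b y` by the coefficient `1`
turns the relator of the path `a y` followed by `c y` into a minimal relation. -/
abbrev killingIdeal : TwoSidedIdeal (PathAlgebra k (Vertex Y)) :=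
  relatorIdeal T (S.indicator 1)

/-- The scalars `1` on the arrows `a x` and `b x`, and `s y` on the arrow `c y`. -/
def tipScalar (s : Y → k) : ∀ {x y : Vertex Y}, (x ⟶ y) → k
  | _, _, Arrow.a _ => 1
  | _, _, Arrow.b _ => 1
  | _, _, Arrow.c y => s y

theorem thinRep_eq_zero_of_isRelator [DecidableEq (Vertex Y)] (hT : IsSaturated T S)
    {f : PathAlgebra k (Vertex Y)} (hf : IsRelator T (S.indicator 1) f) :
    thinRep (tipScalar (S.indicator 1)) f = 0 := by
  cases hf with
  | comm y =>
    simp only [map_sub, map_mul, thinRep_sheared, Matrix.single_mul_single_same, sub_eq_zero]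
    simp [tipScalar, shearCoeff, baseArrow, arrowA, arrowB]
  | @mul x y z h =>
    obtain ⟨hx, hy⟩ := hT h
    simp only [map_sub, map_mul, thinRep_sheared, Matrix.single_mul_single_same, sub_eq_zero]
    by_cases hz : z ∈ S <;>
      simp [tipScalar, shearCoeff, baseArrow, arrowA, arrowB, Set.indicator, hx, hy, hz]
  | tip y =>
    simp only [map_mul, thinRep_sheared, Matrix.single_mul_single_same]
    by_cases hy : y ∈ S <;>
      simp [tipScalar, shearCoeff, baseArrow, arrowA, arrowC, Set.indicator, hy]

theorem ofPath_notMem_killingIdeal (hT : IsSaturated T S) {x y : Vertex Y} {p : Path x y}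
    (hp : p.weight (tipScalar (S.indicator (1 : Y → k))) ≠ 0) :
    ofPath k p ∉ killingIdeal k T S := by
  classical
  have hle : killingIdeal k T S ≤ TwoSidedIdeal.ker (thinRep (tipScalar (S.indicator 1))) :=
    TwoSidedIdeal.span_le.2 fun f hf =>
      (TwoSidedIdeal.mem_ker _).2 (thinRep_eq_zero_of_isRelator hT hf)
  intro hmem
  refine hp ?_
  have hzero := (TwoSidedIdeal.mem_ker _).1 (hle hmem)
  rw [thinRep_ofPath] at hzero
  simpa using congrFun₂ hzero x y

theorem pathAB_notMem_killingIdeal (hT : IsSaturated T S) (x y : Option Y) :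
    ofPath k (pathAB x y) ∉ killingIdeal k T S := by
  refine ofPath_notMem_killingIdeal hT ?_
  rw [pathAB, Path.weight_comp, weight_toPath, weight_toPath]
  simp [tipScalar, arrowA, arrowB]

theorem pathAC_notMem_killingIdeal (hT : IsSaturated T S) (x : Option Y) {y : Y} (hy : y ∈ S) :
    ofPath k (pathAC x y) ∉ killingIdeal k T S := by
  refine ofPath_notMem_killingIdeal hT ?_
  rw [pathAC, Path.weight_comp, weight_toPath, weight_toPath]
  simp [tipScalar, arrowA, arrowC, hy]

theorem homotopic_comm (hT : IsSaturated T S) (y : Y) :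
    Homotopic (killingIdeal k T S) (toWalk (pathAB (some y) none))
      (toWalk (pathAB none (some y))) := by
  refine Homotopic.of_sub_mem ?_ (pathAB_notMem_killingIdeal hT _ _)
  have hmem := (IsRelator.comm (T := T) (s := S.indicator (1 : Y → k)) y).mem_relatorIdeal
  rw [shearedArrow_arrowA_some, shearedArrow_arrowA_none, shearedArrow_arrowB_some,
    shearedArrow_arrowB_none, sub_mul, mul_sub, smul_mul_assoc, mul_smul_comm,
    sub_sub_sub_cancel_right] at hmem
  rwa [pathAB, pathAB, ofPath_comp, ofPath_comp]

theorem homotopic_mul (hT : IsSaturated T S) {x y z : Y} (h : T x y z) (hz : z ∉ S) :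
    Homotopic (killingIdeal k T S) (toWalk (pathAB (some x) (some y)))
      (toWalk (pathAB (some z) none)) := by
  refine Homotopic.of_sub_mem ?_ (pathAB_notMem_killingIdeal hT _ _)
  have hx : x ∉ S := (hT h).1.not.2 hz
  have hy : y ∉ S := (hT h).2.not.2 hz
  have hmem := (IsRelator.mul (s := S.indicator (1 : Y → k)) h).mem_relatorIdeal
  simp only [shearedArrow_arrowA_some, shearedArrow_arrowB_some, shearedArrow_arrowB_none,
    Set.indicator_of_notMem, hx, hy, hz, not_false_eq_true, zero_smul, sub_zero] at hmem
  rwa [pathAB, pathAB, ofPath_comp, ofPath_comp]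

theorem homotopic_tip (hT : IsSaturated T S) {y : Y} (hy : y ∈ S) :
    Homotopic (killingIdeal k T S) (toWalk (pathAC (some y) y)) (toWalk (pathAC none y)) := by
  refine Homotopic.of_sub_mem ?_ (pathAC_notMem_killingIdeal hT _ hy)
  have hmem := (IsRelator.tip (T := T) (s := S.indicator (1 : Y → k)) y).mem_relatorIdeal
  rw [shearedArrow_arrowA_some, shearedArrow_arrowC, Set.indicator_of_mem hy, Pi.one_apply,
    one_smul, sub_mul] at hmem
  rwa [pathAC, pathAC, ofPath_comp, ofPath_comp]

end KilledGenerators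

section ArrowWeight

open PathAlgebra

variable {G : Type*} [Monoid G] {Y : Type*} {β : Y → G}

variable (β) in
/-- The weight `β y` on the arrows `a (some y)` and `b (some y)`, and `1` on all other arrows. -/
def arrowWeight : ∀ {x y : Vertex Y}, (x ⟶ y) → G
  | _, _, Arrow.a x => x.elim 1 β
  | _, _, Arrow.b x => x.elim 1 β
  | _, _, Arrow.c _ => 1

variable {k : Type u} [Field k] {T : Y → Y → Y → Prop} {s : Y → k}

theorem shearCoeff_eq_zero_or_arrowWeight_baseArrow (hβ : ∀ y, s y = 0 ∨ β y = 1) {x y : Vertex Y}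
    (e : x ⟶ y) : shearCoeff s e = 0 ∨ arrowWeight β (baseArrow e) = arrowWeight β e := by
  have hindex : ∀ x : Option Y, x.elim 0 s = 0 ∨ 1 = x.elim 1 β
    | none => Or.inl rfl
    | some y => (hβ y).imp_right Eq.symm
  obtain x | x | y := e
  · exact hindex x
  · exact hindex x
  · exact Or.inl rfl

theorem isWeightGraded_relatorIdeal [Finite Y] (hβ : ∀ y, s y = 0 ∨ β y = 1)
    (hT : ∀ x y z, T x y z → β x * β y = β z) :
    IsWeightGraded (arrowWeight β) (relatorIdeal T s) := by
  have hmul {x y z : Vertex Y} (e : x ⟶ y) (e' : y ⟶ z) : shearedArrow s e * shearedArrow s e' ∈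
      weightSpace k (arrowWeight β) (arrowWeight β e * arrowWeight β e') :=
    mul_mem_weightSpace
      (sheared_mem_weightSpace (shearCoeff_eq_zero_or_arrowWeight_baseArrow hβ e))
      (sheared_mem_weightSpace (shearCoeff_eq_zero_or_arrowWeight_baseArrow hβ e'))
  refine isWeightGraded_span fun f hf => ?_
  cases hf with
  | comm y =>
    have hweight : arrowWeight β (arrowA none) * arrowWeight β (arrowB (some y)) =
        arrowWeight β (arrowA (some y)) * arrowWeight β (arrowB none) :=
      (one_mul (β y)).trans (mul_one (β y)).symm
    exact ⟨_, sub_mem (hmul _ _) (hweight ▸ hmul _ _)⟩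
  | @mul x y z h =>
    have hweight : arrowWeight β (arrowA (some z)) * arrowWeight β (arrowB none) =
        arrowWeight β (arrowA (some x)) * arrowWeight β (arrowB (some y)) :=
      (mul_one (β z)).trans (hT x y z h).symm
    exact ⟨_, sub_mem (hmul _ _) (hweight ▸ hmul _ _)⟩
  | tip y => exact ⟨_, hmul _ _⟩

end ArrowWeight

section ArrowClass

variable (k : Type u) [Field k] {Y : Type*} [Finite Y] (T : Y → Y → Y → Prop) (S : Set Y)

/-- The class of an arrow in the fundamental group at the source. -/
def arrowClass {x y : Vertex Y} (e : x ⟶ y) :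
    FundamentalGroup (killingIdeal k T S) (source : Vertex Y) :=
  loopClass (killingIdeal k T S) treeWalk (toWalk e.toPath)

theorem arrowClass_arrowA_none : arrowClass k T S (arrowA none) = 1 :=
  loopClass_eq_one_of_comp_eq treeWalk rfl

theorem arrowClass_arrowB_none : arrowClass k T S (arrowB none) = 1 :=
  loopClass_eq_one_of_comp_eq treeWalk rfl

theorem arrowClass_arrowC (y : Y) : arrowClass k T S (arrowC y) = 1 :=
  loopClass_eq_one_of_comp_eq treeWalk rfl

theorem loopClass_pathAB (x y : Option Y) :
    loopClass (killingIdeal k T S) treeWalk (toWalk (pathAB x y)) =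
      arrowClass k T S (arrowA x) * arrowClass k T S (arrowB y) :=
  loopClass_toWalk_comp treeWalk _ _

theorem loopClass_pathAC (x : Option Y) (y : Y) :
    loopClass (killingIdeal k T S) treeWalk (toWalk (pathAC x y)) =
      arrowClass k T S (arrowA x) := by
  rw [pathAC, loopClass_toWalk_comp, ← arrowClass, ← arrowClass, arrowClass_arrowC, mul_one]

variable {T S}

theorem arrowClass_arrowB (hT : IsSaturated T S) :
    ∀ x : Option Y, arrowClass k T S (arrowB x) = arrowClass k T S (arrowA x)
  | none => (arrowClass_arrowB_none k T S).trans (arrowClass_arrowA_none k T S).symm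
  | some y => by
    have hcomm := (homotopic_comm (k := k) hT y).loopClass_eq treeWalk
    rw [loopClass_pathAB, loopClass_pathAB, arrowClass_arrowB_none, arrowClass_arrowA_none,
      mul_one, one_mul] at hcomm
    exact hcomm.symm

theorem arrowClass_arrowA_of_mem (hT : IsSaturated T S) {y : Y} (hy : y ∈ S) :
    arrowClass k T S (arrowA (some y)) = 1 := by
  have htip := (homotopic_tip (k := k) hT hy).loopClass_eq treeWalk
  rwa [loopClass_pathAC, loopClass_pathAC, arrowClass_arrowA_none] at htip

theorem arrowClass_arrowA_mul (hT : IsSaturated T S) {x y z : Y} (h : T x y z) :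
    arrowClass k T S (arrowA (some x)) * arrowClass k T S (arrowA (some y)) =
      arrowClass k T S (arrowA (some z)) := by
  by_cases hz : z ∈ S
  · rw [arrowClass_arrowA_of_mem k hT ((hT h).1.2 hz),
      arrowClass_arrowA_of_mem k hT ((hT h).2.2 hz), arrowClass_arrowA_of_mem k hT hz, mul_one]
  · have hmul := (homotopic_mul (k := k) hT h hz).loopClass_eq treeWalk
    rwa [loopClass_pathAB, loopClass_pathAB, arrowClass_arrowB k hT, arrowClass_arrowB_none,
      mul_one] at hmul

end ArrowClass

section FundamentalGroup

variable {Y : Type*} {T : Y → Y → Y → Prop} {S : Set Y}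

variable (T S) in
/-- The weight of an arrow with values in the group presented by `killingRels T S`. -/
abbrev presentedWeight {x y : Vertex Y} (e : x ⟶ y) : PresentedGroup (killingRels T S) :=
  arrowWeight PresentedGroup.of e

theorem closure_presentedWeight : Subgroup.closure
    {g | ∃ (x y : Vertex Y) (e : x ⟶ y), presentedWeight T S e = g} = ⊤ := by
  rw [← top_le_iff, ← PresentedGroup.closure_range_of]
  refine Subgroup.closure_mono ?_
  rintro _ ⟨y, rfl⟩
  exact ⟨_, _, arrowA (some y), rfl⟩

theorem walkWeight_treeWalk :
    ∀ v : Symmetrify (Vertex Y), walkWeight (presentedWeight T S) (treeWalk v) = 1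
  | source => Path.weight_nil _ _
  | middle => (walkWeight_toWalk _ (arrowA none).toPath).trans (weight_toPath _ _)
  | sink => by
    refine (walkWeight_toWalk _ (pathAB none none)).trans ?_
    rw [pathAB, Path.weight_comp, weight_toPath, weight_toPath]
    exact one_mul 1
  | tip y => by
    refine (walkWeight_toWalk _ (pathAC none y)).trans ?_
    rw [pathAC, Path.weight_comp, weight_toPath, weight_toPath]
    exact one_mul 1

variable {k : Type u} [Field k] [Finite Y]

theorem isWeightGraded_killingIdeal :
    PathAlgebra.IsWeightGraded (presentedWeight T S) (killingIdeal k T S) := by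
  refine isWeightGraded_relatorIdeal (fun y => ?_) fun x y z h =>
    of_mul_of_eq_of_triangleRels_subset Set.subset_union_left h
  by_cases hy : y ∈ S
  · exact Or.inr (of_eq_one_of_mem T hy)
  · exact Or.inl (Set.indicator_of_notMem hy 1)

variable (k) in
/-- The homomorphism that sends each `y : Y` to the class of the arrow `a (some y)`. -/
def arrowClassHom (hT : IsSaturated T S) :
    PresentedGroup (killingRels T S) →* FundamentalGroup (killingIdeal k T S) (source : Vertex Y) :=
  PresentedGroup.toGroup (f := fun y => arrowClass k T S (arrowA (some y))) <|
    lift_eq_one_of_mem_killingRels (fun _ _ _ => arrowClass_arrowA_mul k hT)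
      fun _ => arrowClass_arrowA_of_mem k hT

theorem arrowClassHom_presentedWeight (hT : IsSaturated T S) {x y : Vertex Y} (e : x ⟶ y) :
    arrowClassHom k hT (presentedWeight T S e) = arrowClass k T S e := by
  have hindex : ∀ x : Option Y,
      arrowClassHom k hT (x.elim 1 PresentedGroup.of) = arrowClass k T S (arrowA x)
    | none => (map_one _).trans (arrowClass_arrowA_none k T S).symm
    | some y => PresentedGroup.toGroup.of ..
  obtain x | x | y := e
  · exact hindex x
  · exact (hindex x).trans (arrowClass_arrowB k hT x).symm
  · exact (map_one _).trans (arrowClass_arrowC k T S y).symm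

variable (k) in
/-- The fundamental group at an arbitrary vertex, computed by transport to the source. -/
def fundamentalGroupEquiv (hT : IsSaturated T S) (v₀ : Vertex Y) :
    FundamentalGroup (killingIdeal k T S) v₀ ≃* PresentedGroup (killingRels T S) :=
  (fundamentalGroupEquivOfWalk _ (treeWalk v₀).reverse).trans
    (fundamentalGroupEquivOfWeight (t := treeWalk) (φ := arrowClassHom k hT)
      isWeightGraded_killingIdeal closure_presentedWeight rfl walkWeight_treeWalk
      (arrowClassHom_presentedWeight hT))

end FundamentalGroup

end Vertex

end BoundQuiver

end

theorem theoremA (k : Type u) [Field k] {n : ℕ} (G : Fin n → Type v)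
    [∀ i, Group (G i)] (hG : ∀ i, Group.IsFinitelyPresented (G i)) :
    ∃ (A : Type u) (_ : Ring A) (_ : Algebra k A)
      (Q : Type) (_ : Fintype Q) (_ : Quiver.{0} Q)
      (I : Fin n → TwoSidedIdeal (BoundQuiver.PathAlgebra k Q)),
      FiniteDimensional k A ∧
      ∀ i, BoundQuiver.IsPresentation A (I i) ∧
        ∀ v₀ : Q, Nonempty (BoundQuiver.FundamentalGroup (I i) v₀ ≃* G i) := by
  choose X _ T e using fun i => BoundQuiver.exists_mulEquiv_presentedGroup_triangleRels (hG i)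
  let Y := Σ i, X i
  let table : Y → Y → Y → Prop := BoundQuiver.SigmaTable T
  open BoundQuiver PathAlgebra Vertex in
  refine ⟨PathAlgebra k (Vertex Y) ⧸ (relatorIdeal table (0 : Y → k)).asIdeal, inferInstance,
    inferInstance, Vertex Y, inferInstance, inferInstance,
    fun i => killingIdeal k table (otherBlocks X i), finiteDimensional_quotient finite_anyPath _,
    fun i => ⟨isPresentation_relatorIdeal table _, fun v₀ => ?_⟩⟩
  obtain ⟨ei⟩ := e i
  open BoundQuiver Vertex in
  exact ⟨(fundamentalGroupEquiv k (isSaturated_otherBlocks T i) v₀).trans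
    ((presentedGroupSigmaTableEquiv T i).trans ei)⟩
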